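/- **Setting.** Let $n>1$ and let $\mathscr J^{+},\mathscr J^{-}$ be two partitions of $[1,n]$ into intervals. Let $\pi=\{\alpha_1,\dots,\alpha_{n-1}\}$, $\alpha_i=\varepsilon_i-\varepsilon_{i+1}$, and let $\pi^\pm$ be the set of the $\alpha_i$ such that $i,i+1$ lie in one part of $\mathscr J^\pm$. Assume $\pi^+\cup\pi^-=\pi$ and $\pi^+\cap\pi^-\subsetneq\pi$. A root $\varepsilon_i-\varepsilon_j$ is called *nil* if some $\alpha_k\notin\pi^+\cap\pi^-$ occurs in it. For an interval $J$ let $\kappa_J$ be the reversal of $J$. *Markings.* For each part $J=[c,d]$ of $\mathscr J^+$ (resp. $\mathscr J^-$) and each pair $\{p,q\}$ (possibly $p=q$) with $c\le p,q<d$ and $p+q+1=c+d$, draw a half-integer arc above (resp. below) the line joining $p+\frac12$ and $q+\frac12$. On each connected component of the resulting graph on $\{\frac32,\dots,n-\frac12\}$ mark exactly one arc; if the component has an arc joining a point to itself, the marked arc must be such an arc. An arc $\{p,q\}$, $p\le q$, is recorded as a mark at $p$ on the arc of $\kappa_J$ joining $p$ and $q+1=\kappa_J(p)$. *Modified involutions.*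 An orbit of the group generated by two involutions is called an *edge* if it is also an orbit of the cyclic group generated by their product, and a *loop* otherwise. Let $\sigma^\pm$ be involutions of $[1,n]$ obtained as follows. Let $J=[c,d]$ be a part of $\mathscr J^\pm$, $m=|J|$, $\ell=c+\lfloor m/2\rfloor-1$, and let $M_J\subset[c,\ell]$ be its set of marks. For each maximal interval $[r,s-1]$ of $M_J$ put $L=[r,s-1]$ if $m$ is even and $s-1=\ell$, and $L=[r,s]$ otherwise. On $X=L\cup\kappa_J(L)$ replace $\kappa_J$ by any involution $\sigma$ of $X$ such that $X$ is a single loop (if $s-1<\ell$), resp. a single edge (if $s-1=\ell$), of $\langle\kappa_J|_X,\sigma\rangle$, and such that every $\{x,\sigma(x)\}$ with $\sigma(x)\ne x$ has one element in $L$ and the other in $\kappa_J(L)$. Elsewhere $\sigma^\pm=\kappa_J$ on $J$. *Edges.* Let $E\subset[1,n]$ be an edge of $\langle\sigma^+,\sigma^-\rangle$ with $e=|E|>1$, and let $a\neq b$ be its two elements fixed by $\sigma^+$ or $\sigma^-$ (in either order). Let $\varphi:[1,e]\to E$ be the enumeration of $E$ with $\varphi(1)=a$, obtained by applying $\sigma^-$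 and $\sigma^+$ alternately, beginning with the one that does not fix $a$; so $\varphi(e)=b$. Each pair $p<q$ with $\sigma^+(p)=q$ gives a directed arc $p\to q$, and each pair $p<q$ with $\sigma^-(p)=q$ gives a directed arc $q\to p$. A point $\varphi(t)$, $1<t<e$, is an *internal turning point* if $\varphi(t)-\varphi(t-1)$ and $\varphi(t)-\varphi(t+1)$ have different signs; the *turning points* are these and $a,b$. A turning point is of type $A$ (a source) if all arcs at it point away from it, and of type $B$ (a sink) if all arcs at it point towards it. Write $\beta_t=\varepsilon_{\varphi(t)}-\varepsilon_{\varphi(t+1)}$. The points $\varphi(1),\dots,\varphi(e)$ are ordered from top to bottom; "above", "below", "first", "last" refer to this order. *Signature.* To each internal turning point $\varphi(t)$ assign a marked value: $\beta_{t-1}$ (positive signature) or $\beta_t$ (negative signature). If exactly one of $\beta_{t-1},\beta_t$ is nil, the non-nil one is marked; if both are nil, $\beta_{t-1}$ is marked; if neither is nil, the choice is free. Let $A_-$, $B_-$ be the sets of internal turning points of type $A$, resp. $B$, with negative signature. *Straightening.* For each internal turning point $\varphi(t)$, delete the arc of its marked value, with end points $\varphi(t)$ and $\varphi(w)$ ($w=t-1$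 or $w=t+1$), and replace it by an arc between $\varphi(w)$ and $\varphi(s)$ with the same direction at $\varphi(w)$. If the signature is positive, $\varphi(s)$ is the first turning point of type opposite to $\varphi(t)$ below $\varphi(t)$. If it is negative, $\varphi(s)$ is the first turning point of opposite type below $\varphi(r)$, where $\varphi(r)$ is the lowest turning point strictly above $\varphi(t)$ that is internal, of the same type as $\varphi(t)$ and of negative signature; if there is no such $\varphi(r)$, then $\varphi(s)$ is the first turning point of opposite type. **Proposition 8.2.** The directed arcs so obtained (new arcs and undeleted arcs) form a single directed path $E^*$ through all the points of $E$, the straightened edge. Let $a^*$ be its starting point and $b^*$ its finishing point. 1. $a^*,b^*$ are turning points of $E$, with $a^*$ of type $A$ and $b^*$ of type $B$. 2. If $B_-\neq\emptyset$, then $a^*$ is the turning point immediately after the last element of $B_-$, and it is of type $A$. Otherwise $a^*$ is the first turning point of type $A$. 3. If $A_-\neq\emptyset$, then $b^*$ is the turning point immediately after the last element of $A_-$, and it is of type $B$. Otherwise $b^*$ is the first turning point of type $B$. 4. $a^*=a$ if and only if $a$ is of type $A$ and $B_-=\emptyset$. 5. $a^*=b$ if and only if $b$ is of type $A$ and, in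 case $E$ has an internal turning point, there is an internal turning point of type $B$ and the last one has negative signature. 6. $b^*=a$ if and only if $a$ is of type $B$ and $A_-=\emptyset$. 7. $b^*=b$ if and only if $b$ is of type $B$ and, in case $E$ has an internal turning point, there is an internal turning point of type $A$ and the last one has negative signature. -/

import Mathlib

namespace Biparabolic

/-! ### Double partitions

The sign `true` stands for `+` (above the line `L`), the sign `false` for `-` (below `L`).
The simple root `α_i = ε_i - ε_{i+1}`, `1 ≤ i ≤ n - 1` (equivalently the half-integer point
`i + 1/2` of `L`) is encoded by the integer `i`, so that `π` is `Set.Ico 1 n`. -/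

/-- A double partition `𝒥⁺, 𝒥⁻` of `[1, n]`: two partitions of `[1, n]` into connected subsets. -/
structure DoublePartition (n : ℕ) where
  part : Bool → Finpartition (Finset.Icc (1 : ℤ) n)
  connected : ∀ s, ∀ J ∈ (part s).parts, ∃ lo hi : ℤ, J = Finset.Icc lo hi

/-- `[lo, hi]` is one of the connected components of `𝒥^s`. -/
def DoublePartition.IsComponent {n : ℕ} (P : DoublePartition n) (s : Bool) (lo hi : ℤ) : Prop :=
  lo ≤ hi ∧ Finset.Icc lo hi ∈ (P.part s).parts

/-- The subset `π^s` of simple roots `α_i` such that `i, i + 1` lie in one component of `𝒥^s`. -/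
def DoublePartition.simpleRoots {n : ℕ} (P : DoublePartition n) (s : Bool) : Set ℤ :=
  {i | ∃ lo hi, P.IsComponent s lo hi ∧ lo ≤ i ∧ i + 1 ≤ hi}

/-- The root `ε_i - ε_j` is nil if its support (the set of simple roots `α_k` with
`min i j ≤ k < max i j`) meets `π̂⁺ ∪ π̂⁻`, where `π̂^± = π ∖ π^±`. -/
def DoublePartition.IsNil {n : ℕ} (P : DoublePartition n) (i j : ℤ) : Prop :=
  ∃ k, min i j ≤ k ∧ k < max i j ∧
    k ∈ (Set.Ico (1 : ℤ) n \ P.simpleRoots true) ∪ (Set.Ico (1 : ℤ) n \ P.simpleRoots false)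

/-! ### Markings of half-integer arcs -/

/-- The half-integer arc above (`s = true`) or below (`s = false`) `L` joining the half-integer
points `p + 1/2` and `q + 1/2`: these are exchanged by the diagram automorphism of the component
of `π^s` containing `α_p`. -/
def DoublePartition.HalfArc {n : ℕ} (P : DoublePartition n) (s : Bool) (p q : ℤ) : Prop :=
  ∃ lo hi, P.IsComponent s lo hi ∧ lo ≤ p ∧ p + 1 ≤ hi ∧ p + q + 1 = lo + hi

/-- The (non-fictitious) half-integer arcs, each encoded by its sign and its left end. The arc
`(s, p)` lies directly inside the integer arc of `κ^s` joining `p` to `κ^s(p)`, and represents the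
same root of the Kostant cascade as the latter. -/
def DoublePartition.halfArcs {n : ℕ} (P : DoublePartition n) : Set (Bool × ℤ) :=
  {m | ∃ q, m.2 ≤ q ∧ P.HalfArc m.1 m.2 q}

/-- Two simple roots lie on the same half-integer meander. (The fictitious arcs that complete the
partially defined involutions `ι^±` only join, possibly through one fictitious root, the two free
ends of a meander, or a free end to itself; so they do not enlarge the meanders.) -/
def DoublePartition.SameHalfMeander {n : ℕ} (P : DoublePartition n) : ℤ → ℤ → Prop :=
  Relation.EqvGen fun p q => ∃ s, P.HalfArc s p q

/-- A set of markings: exactly one non-fictitious half-integer arc is marked on each half-integer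
meander; if the meander is an edge, the marked arc joins a fixed point of `ι⁺` or `ι⁻` to itself.
(The half-integer meander, completed by fictitious arcs, is an edge if and only if one of its
non-fictitious arcs joins a point to itself: a fictitious arc joins a point to itself only when
following the meander from that free end leads to a non-fictitious fixed point and back; otherwise
the meander is a loop and any of its non-fictitious arcs may be marked.) -/
def DoublePartition.IsMarking {n : ℕ} (P : DoublePartition n) (M : Set (Bool × ℤ)) : Prop :=
  M ⊆ P.halfArcs ∧
  (∀ p ∈ Set.Ico (1 : ℤ) n, ∃! m, m ∈ M ∧ P.SameHalfMeander p m.2) ∧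
  (∀ m ∈ M, (∃ s p, P.SameHalfMeander m.2 p ∧ P.HalfArc s p p) → P.HalfArc m.1 m.2 m.2)

/-! ### Meanders, loops and edges -/

/-- A meander of two involutions `σ, τ` is an orbit of the group generated by them. -/
def IsMeander (σ τ : Equiv.Perm ℤ) (X : Set ℤ) : Prop :=
  ∃ x, X = MulAction.orbit (Subgroup.closure {σ, τ}) x

/-- An edge is a meander which is also an orbit of the group generated by `σ τ`. -/
def IsEdge (σ τ : Equiv.Perm ℤ) (X : Set ℤ) : Prop :=
  IsMeander σ τ X ∧ ∃ x, X = MulAction.orbit (Subgroup.zpowers (σ * τ)) x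

/-- A loop is a meander which is not an edge. -/
def IsLoop (σ τ : Equiv.Perm ℤ) (X : Set ℤ) : Prop :=
  IsMeander σ τ X ∧ ¬ IsEdge σ τ X

/-! ### Anti-Toeplitz involutions -/

/-- The involution `κ_J` for `J = [lo, hi]`: the reflection of `J`, and the identity outside. -/
def kappa (lo hi : ℤ) : Equiv.Perm ℤ :=
  Function.Involutive.toPerm (fun x => if lo ≤ x ∧ x ≤ hi then lo + hi - x else x) (by
    intro x
    by_cases h : lo ≤ x ∧ x ≤ hi
    · have h' : lo ≤ lo + hi - x ∧ lo + hi - x ≤ hi := by omega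
      simp [h, h']
    · simp [h])

/-- For `J = [lo, hi]` the Kostant cascade consists of the arcs from `i` to `κ_J(i)` with
`lo ≤ i ≤ lastArc lo hi`; this plays the role of the index `[n/2]` for `J = [1, n]`. -/
def lastArc (lo hi : ℤ) : ℤ := lo + (hi - lo + 1) / 2 - 1

/-- `[r, s - 1]` is a connected component of the set `M` of marked arcs of `J = [lo, hi]`. -/
def IsMarkedInterval (lo hi : ℤ) (M : Set ℤ) (r s : ℤ) : Prop :=
  lo ≤ r ∧ r ≤ s - 1 ∧ s - 1 ≤ lastArc lo hi ∧ (∀ i, r ≤ i → i ≤ s - 1 → i ∈ M) ∧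
    (r = lo ∨ r - 1 ∉ M) ∧ (s - 1 = lastArc lo hi ∨ s ∉ M)

/-- The left half `[r, s⁻]` of the extended component attached to `[r, s - 1]`: here
`s⁻ = s - 1` if `|J|` is even and `s - 1` is the last index, and `s⁻ = s` otherwise. -/
def leftHalf (lo hi r s : ℤ) : Set ℤ :=
  if Even (hi - lo + 1) ∧ s - 1 = lastArc lo hi then Set.Icc r (s - 1) else Set.Icc r s

/-- The extended component `ℳ_{r,s} = [r, s⁻] ∪ κ_J([r, s⁻])`. -/
def extended (lo hi r s : ℤ) : Set ℤ :=
  leftHalf lo hi r s ∪ kappa lo hi '' leftHalf lo hi r s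

/-- On `J = [lo, hi]`, with set of marked arcs `M`, the permutation `σ` is obtained from `κ_J` by
replacing, on each extended component, `κ_J` by an anti-Toeplitz involution, that is one with the
properties `T(i)` (single loop or edge through all points) and `T(ii)` (every non-trivial arc joins
the left half to the right half). -/
def IsAntiToeplitz (lo hi : ℤ) (M : Set ℤ) (σ : Equiv.Perm ℤ) : Prop :=
  (∀ r s, IsMarkedInterval lo hi M r s →
    (s - 1 < lastArc lo hi → IsLoop (kappa lo hi) σ (extended lo hi r s)) ∧
    (s - 1 = lastArc lo hi → IsEdge (kappa lo hi) σ (extended lo hi r s)) ∧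
    (∀ x ∈ extended lo hi r s, σ x ≠ x →
      (x ∈ leftHalf lo hi r s ∧ σ x ∈ kappa lo hi '' leftHalf lo hi r s) ∨
      (σ x ∈ leftHalf lo hi r s ∧ x ∈ kappa lo hi '' leftHalf lo hi r s))) ∧
  (∀ x, lo ≤ x → x ≤ hi →
    (∀ r s, IsMarkedInterval lo hi M r s → x ∉ extended lo hi r s) → σ x = kappa lo hi x)

/-- `σ⁺ = σ true` and `σ⁻ = σ false` are modified involutions of `[1, n]` (extended by the identity
to `ℤ`) attached to the double partition `P` and the set `M` of markings. -/
def DoublePartition.IsModified {n : ℕ} (P : DoublePartition n) (M : Set (Bool × ℤ))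
    (σ : Bool → Equiv.Perm ℤ) : Prop :=
  ∀ s, (∀ x, σ s (σ s x) = x) ∧ (∀ x, x ∉ Set.Icc (1 : ℤ) n → σ s x = x) ∧
    ∀ lo hi, P.IsComponent s lo hi → IsAntiToeplitz lo hi {p | (s, p) ∈ M} (σ s)

/-! ### The points, turning points, sources and sinks of an edge

Below, `a` is the starting point and `e` the number of points of an edge of `σ⁺, σ⁻`. The points
`φ(1), …, φ(e)` are placed from top to bottom on the vertical line `V`, and a subset of the edge is
given as a set of positions `t ∈ [1, e]`. -/

/-- The alternating word of length `k` in `σ, τ` starting with `σ` on the right. -/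
def altWord (σ τ : Equiv.Perm ℤ) : ℕ → Equiv.Perm ℤ
  | 0 => 1
  | k + 1 => (if Even k then σ else τ) * altWord σ τ k

open Classical in
/-- The point `φ(t)`, `t ≥ 1`: the word of length `t - 1` applied to `a`, the word starting with
`σ⁻` if `a` is fixed by `σ⁺`, and with `σ⁺` otherwise. -/
noncomputable def phi (σ : Bool → Equiv.Perm ℤ) (a : ℤ) (t : ℕ) : ℤ :=
  if σ true a = a then altWord (σ false) (σ true) (t - 1) a
  else altWord (σ true) (σ false) (t - 1) a

/-- `(p, q)` is a non-trivial directed arc: above `L` arrows point from left to right, below `L`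
from right to left. -/
def DirArc (σ : Bool → Equiv.Perm ℤ) (p q : ℤ) : Prop :=
  (p < q ∧ σ true p = q) ∨ (q < p ∧ σ false p = q)

/-- Positions of the internal turning points. -/
def internalTP (σ : Bool → Equiv.Perm ℤ) (a : ℤ) (e : ℕ) : Set ℕ :=
  {t | 2 ≤ t ∧ t ≤ e - 1 ∧
    Int.sign (phi σ a t - phi σ a (t - 1)) ≠ Int.sign (phi σ a t - phi σ a (t + 1))}

/-- Positions of all turning points: the two end-points and the internal turning points. -/
def turningPoints (σ : Bool → Equiv.Perm ℤ) (a : ℤ) (e : ℕ) : Set ℕ :=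
  {1, e} ∪ internalTP σ a e

/-- The type of a turning point: `TP σ a e true` is the set `A` of sources (every directed arc
meeting the point starts there), `TP σ a e false` is the set `B` of sinks (every directed arc
meeting the point finishes there). -/
def TP (σ : Bool → Equiv.Perm ℤ) (a : ℤ) (e : ℕ) : Bool → Set ℕ
  | true => {t ∈ turningPoints σ a e | ∀ p q, DirArc σ p q →
      (p = phi σ a t ∨ q = phi σ a t) → p = phi σ a t}
  | false => {t ∈ turningPoints σ a e | ∀ p q, DirArc σ p q →
      (p = phi σ a t ∨ q = phi σ a t) → q = phi σ a t}

/-! ### Signatures and the straightened edge -/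

/-- `β_t = ε_{φ(t)} - ε_{φ(t+1)}` is nil. -/
def DoublePartition.NilValue {n : ℕ} (P : DoublePartition n) (σ : Bool → Equiv.Perm ℤ) (a : ℤ)
    (t : ℕ) : Prop :=
  P.IsNil (phi σ a t) (phi σ a (t + 1))

/-- An admissible signature. To each internal turning point `φ(t)` one assigns a marked boundary
value: `sg t = 1` if it is `β_{t-1}` (above `φ(t)`), `sg t = -1` if it is `β_t` (below `φ(t)`).
If exactly one of `β_{t-1}, β_t` is nil the other one is marked, if both are nil `β_{t-1}` is
marked, and if neither is nil either one may be marked. -/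
def DoublePartition.IsSignature {n : ℕ} (P : DoublePartition n) (σ : Bool → Equiv.Perm ℤ) (a : ℤ)
    (e : ℕ) (sg : ℕ → ℤˣ) : Prop :=
  ∀ t ∈ internalTP σ a e,
    (P.NilValue σ a (t - 1) → ¬ P.NilValue σ a t → sg t = -1) ∧
    (¬ P.NilValue σ a (t - 1) → P.NilValue σ a t → sg t = 1) ∧
    (P.NilValue σ a (t - 1) → P.NilValue σ a t → sg t = 1)

/-- The internal turning points of negative signature of type `A` or `B`: `negTP σ a e sg true` is
`A₋` and `negTP σ a e sg false` is `B₋`. -/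
def negTP (σ : Bool → Equiv.Perm ℤ) (a : ℤ) (e : ℕ) (sg : ℕ → ℤˣ) (c : Bool) : Set ℕ :=
  {t | t ∈ internalTP σ a e ∧ t ∈ TP σ a e c ∧ sg t = -1}

/-- The index `i` of the marked value `β_i` assigned to `φ(t)`. -/
def markedIndex (sg : ℕ → ℤˣ) (t : ℕ) : ℕ := if sg t = 1 then t - 1 else t

/-- The position of the end, other than `φ(t)`, of the marked short line assigned to `φ(t)`. -/
def outerEnd (sg : ℕ → ℤˣ) (t : ℕ) : ℕ := if sg t = 1 then t - 1 else t + 1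

/-- The external arc assigned to the internal turning point `φ(t)` of type `c` crosses `φ(s)`.
For positive signature `φ(s)` is the first turning point of the opposite type below `φ(t)`. For
negative signature, if there are turning points of type `c` and negative signature strictly above
`φ(t)` and `φ(r)` is the lowest of them, `φ(s)` is the first turning point of the opposite type
below `φ(r)`; otherwise `φ(s)` is the first turning point of the opposite type. -/
def Crosses (σ : Bool → Equiv.Perm ℤ) (a : ℤ) (e : ℕ) (sg : ℕ → ℤˣ) (c : Bool) (t s : ℕ) : Prop :=
  (sg t = 1 ∧ IsLeast {u ∈ TP σ a e (!c) | t < u} s) ∨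
  (sg t = -1 ∧
    ((∃ r, IsGreatest {r ∈ negTP σ a e sg c | r < t} r ∧ IsLeast {u ∈ TP σ a e (!c) | r < u} s) ∨
     ({r ∈ negTP σ a e sg c | r < t} = ∅ ∧ IsLeast (TP σ a e (!c)) s)))

/-- The directed arcs of the straightened edge: the unmarked short arcs, and, for each internal
turning point `φ(t)`, the external arc which replaces the deleted short arc assigned to `φ(t)`. It
joins the outer end of the deleted arc to the crossed point `φ(s)` and has the same direction as
the deleted arc. -/
def StarArc (σ : Bool → Equiv.Perm ℤ) (a : ℤ) (e : ℕ) (sg : ℕ → ℤˣ) (p q : ℤ) : Prop :=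
  (∃ i, 1 ≤ i ∧ i < e ∧ (∀ t ∈ internalTP σ a e, markedIndex sg t ≠ i) ∧ DirArc σ p q ∧
    ((p = phi σ a i ∧ q = phi σ a (i + 1)) ∨ (p = phi σ a (i + 1) ∧ q = phi σ a i))) ∨
  (∃ t ∈ internalTP σ a e, ∃ c s, t ∈ TP σ a e c ∧ Crosses σ a e sg c t s ∧
    ((DirArc σ (phi σ a t) (phi σ a (outerEnd sg t)) ∧
        p = phi σ a s ∧ q = phi σ a (outerEnd sg t)) ∨
     (DirArc σ (phi σ a (outerEnd sg t)) (phi σ a t) ∧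
        p = phi σ a (outerEnd sg t) ∧ q = phi σ a s)))

/-- `ψ(1), …, ψ(e)` is the straightened edge `E*` of `E`: it passes exactly once through each point
of `E`, and the directed arcs of the straightening are exactly the arcs from `ψ(j)` to `ψ(j + 1)`
(so they form a single edge with all arrows aligned, starting at `ψ(1)` and finishing
at `ψ(e)`). -/
def IsStraightening (σ : Bool → Equiv.Perm ℤ) (a : ℤ) (E : Set ℤ) (sg : ℕ → ℤˣ) (ψ : ℕ → ℤ) :
    Prop :=
  Set.BijOn ψ (Set.Icc 1 E.ncard) E ∧
  ∀ p q, StarArc σ a E.ncard sg p q ↔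
    ∃ j, 1 ≤ j ∧ j < E.ncard ∧ p = ψ j ∧ q = ψ (j + 1)

end Biparabolic

open Biparabolic

/-! Build the edge up one point at a time, from top to bottom, straightening the path of the first
`m` points. When the point `m + 1` is added, the new path arises from the old one as follows. If
`m` is an internal turning point of negative signature, `m + 1` is attached to an end of the old
path: to its starting point if the arc between `m` and `m + 1` points to `m`, and to its finishing
point otherwise. In all other cases `m + 1` is inserted next to `m`, before or after it according
to the direction of that arc. Hence the straightening is always a path and its two ends can be
followed explicitly; reversing the path exchanges sources and sinks, so that only one of the two
directions has to be considered.

The anti-Toeplitz involutions enter only through the fact that no arc is marked from both of its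
ends: the arc between two consecutive internal turning points is nil. -/

namespace Biparabolic

section Lists

variable {α : Type*} {i j x y : α} {l l₁ l₂ : List α}

lemma pair_infix_cons_iff : [i, j] <:+: x :: l ↔ (i = x ∧ l.head? = some j) ∨ [i, j] <:+: l := by
  rw [List.infix_cons_iff, List.cons_prefix_cons]
  cases l <;> grind

lemma pair_infix_iff_getElem? :
    [i, j] <:+: l ↔ ∃ k, l[k]? = some i ∧ l[k + 1]? = some j := by
  induction l with
  | nil => simp
  | cons x l ih =>
    rw [pair_infix_cons_iff, ih, List.head?_eq_getElem?]
    refine ⟨?_, ?_⟩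
    · rintro (⟨rfl, h⟩ | ⟨k, hk⟩)
      · exact ⟨0, rfl, h⟩
      · exact ⟨k + 1, hk⟩
    · rintro ⟨_ | k, hi, hj⟩
      · exact .inl ⟨by simpa using hi.symm, hj⟩
      · exact .inr ⟨k, hi, hj⟩

lemma not_pair_infix_cons_self (h : x ∉ l) : ¬ [i, x] <:+: x :: l := by
  rw [pair_infix_cons_iff]
  rintro (⟨-, hx⟩ | hx)
  · exact h (List.mem_of_mem_head? hx)
  · exact h (hx.subset (by simp))

lemma pair_infix_insert_iff (h₁ : x ∉ l₁) (h₂ : x ∉ l₂) :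
    [i, j] <:+: l₁ ++ y :: x :: l₂ ↔
      ([i, j] <:+: l₁ ++ x :: l₂ ∧ j ≠ x) ∨ ([i, x] <:+: l₁ ++ x :: l₂ ∧ j = y) ∨
        (i = y ∧ j = x) := by
  induction l₁ with
  | nil =>
    have not_infix : ¬ [i, x] <:+: x :: l₂ := not_pair_infix_cons_self h₂
    simp only [List.nil_append]
    rw [pair_infix_cons_iff]
    grind
  | cons z l₁ ih =>
    simp only [List.cons_append, pair_infix_cons_iff, ih (List.not_mem_of_not_mem_cons h₁)]
    cases l₁ <;> grind

end Lists

section OrientedPath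

variable {d : ℕ → Bool} {g : ℕ → ℤˣ} {m k t r u i j : ℕ} {c : Bool}

/-- In the path `1 — 2 — ⋯` whose arc between `t` and `t + 1` is directed downwards, from `t` to
`t + 1`, if and only if `d t = true`, the point `t` is a turning point with two neighbours. -/
def IsTurn (d : ℕ → Bool) (t : ℕ) : Prop := 2 ≤ t ∧ d t = !d (t - 1)

/-- The point `t` of the path `1 — 2 — ⋯ — m` directed by `d` is a source (`c = true`) or a sink
(`c = false`). If `m = 1` then the only point is both. -/
def HasType (d : ℕ → Bool) (m : ℕ) (c : Bool) (t : ℕ) : Prop :=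
  1 ≤ t ∧ t ≤ m ∧ (2 ≤ t → d (t - 1) = !c) ∧ (t < m → d t = c)

/-- The first point of type `c` below `r` of the path `1 — 2 — ⋯ — m` directed by `d`; the junk
value is `0` if there is none. -/
noncomputable def firstOfType (d : ℕ → Bool) (m : ℕ) (c : Bool) (r : ℕ) : ℕ :=
  sInf {u | HasType d m c u ∧ r < u}

/-- A turning point with two neighbours and negative signature, so that the arc below it is
deleted by the straightening. -/
def IsNegTurn (d : ℕ → Bool) (g : ℕ → ℤˣ) (t : ℕ) : Prop := IsTurn d t ∧ g t = -1

/-- The last turning point of type `c` and negative signature above `t`, with the convention that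
it is `0` if there is none; then everything is below it. -/
noncomputable def lastNeg (d : ℕ → Bool) (g : ℕ → ℤˣ) (c : Bool) (t : ℕ) : ℕ :=
  sSup {r | IsNegTurn d g r ∧ d r = c ∧ r < t}

/-- The starting point (`c = true`) or the finishing point (`c = false`) of the straightening of
the path `1 — 2 — ⋯ — m` directed by `d`, for the signature `g`. -/
noncomputable def pathEnd (d : ℕ → Bool) (g : ℕ → ℤˣ) (m : ℕ) (c : Bool) : ℕ :=
  firstOfType d m c (lastNeg d g (!c) m)

open Classical in
/-- The end of the `k`-th arc of the straightening that replaces the upper end `k` of the arc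
between `k` and `k + 1`. By `firstOfType_eq_of_lt` the point crossed may be sought in the path
`1 — 2 — ⋯ — k`, which makes it the end of the straightening of that path. -/
noncomputable def upperEnd (d : ℕ → Bool) (g : ℕ → ℤˣ) (k : ℕ) : ℕ :=
  if IsNegTurn d g k then pathEnd d g k (!d k) else k

open Classical in
/-- The end of the `k`-th arc of the straightening of `1 — 2 — ⋯ — m` that replaces the lower end
`k + 1` of the arc between `k` and `k + 1`. -/
noncomputable def lowerEnd (d : ℕ → Bool) (g : ℕ → ℤˣ) (m k : ℕ) : ℕ :=
  if IsTurn d (k + 1) ∧ k + 1 < m ∧ g (k + 1) = 1 then firstOfType d m (d k) (k + 1) else k + 1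

/-- The straightening of `1 — 2 — ⋯ — m` has an arc from `i` to `j` (`c = true`), respectively from
`j` to `i` (`c = false`). -/
def StraightArc (d : ℕ → Bool) (g : ℕ → ℤˣ) (m : ℕ) (c : Bool) (i j : ℕ) : Prop :=
  ∃ k, 1 ≤ k ∧ k < m ∧
    if d k = c then i = upperEnd d g k ∧ j = lowerEnd d g m k
    else i = lowerEnd d g m k ∧ j = upperEnd d g k

lemma hasType_succ_iff (hm : 1 ≤ m) :
    HasType d (m + 1) c t ↔
      (HasType d m c t ∧ ¬ (t = m ∧ d m = !c)) ∨ (t = m + 1 ∧ d m = !c) := by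
  have : d m = c ∨ d m = !c := Bool.eq_or_eq_not _ _
  rcases lt_trichotomy t (m + 1) with h | rfl | h <;> grind [HasType]

lemma isLeast_firstOfType (hr : 1 ≤ r → d r = !c) (hrm : r < m) :
    IsLeast {u | HasType d m c u ∧ r < u} (firstOfType d m c r) := by
  suffices h : ∃ u, HasType d m c u ∧ r < u from ⟨Nat.sInf_mem h, fun _ ↦ Nat.sInf_le⟩
  induction m, hrm using Nat.le_induction with
  | base => exact ⟨r + 1, by grind [HasType]⟩
  | succ m hrm ih =>
    obtain ⟨u, hu, hru⟩ := ih
    by_cases hum : u = m ∧ d m = !c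
    · exact ⟨m + 1, (hasType_succ_iff (by omega)).2 (.inr ⟨rfl, hum.2⟩), by omega⟩
    · exact ⟨u, (hasType_succ_iff (by omega)).2 (.inl ⟨hu, hum⟩), hru⟩

lemma firstOfType_eq_iff (hr : 1 ≤ r → d r = !c) (hrm : r < m) :
    firstOfType d m c r = u ↔ IsLeast {u | HasType d m c u ∧ r < u} u :=
  ⟨fun h ↦ h ▸ isLeast_firstOfType hr hrm, fun h ↦ (isLeast_firstOfType hr hrm).unique h⟩

lemma firstOfType_succ_self (hr : 1 ≤ r → d r = !c) : firstOfType d (r + 1) c r = r + 1 := by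
  rw [firstOfType_eq_iff hr r.lt_succ_self]
  exact ⟨by grind [HasType], fun v hv ↦ hv.2⟩

lemma firstOfType_succ (hr : 1 ≤ r → d r = !c) (hrm : r < m) :
    firstOfType d (m + 1) c r =
      if firstOfType d m c r = m ∧ d m = !c then m + 1 else firstOfType d m c r := by
  obtain ⟨⟨hu, hru⟩, hmin⟩ := isLeast_firstOfType hr hrm
  rw [firstOfType_eq_iff hr (hrm.trans m.lt_succ_self)]
  simp only [mem_lowerBounds, Set.mem_ofPred_eq] at hmin
  simp only [IsLeast, mem_lowerBounds, Set.mem_ofPred_eq, hasType_succ_iff (by omega : 1 ≤ m)]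
  have := hu.2.1
  split_ifs with h <;> grind

lemma firstOfType_eq_of_lt (hr : 1 ≤ r → d r = !c) (hrt : r < t) (ht : firstOfType d t c r < t)
    (htm : t ≤ m) : firstOfType d m c r = firstOfType d t c r := by
  induction m, htm using Nat.le_induction with
  | base => rfl
  | succ m htm ih => rw [firstOfType_succ hr (hrt.trans_le htm), ih, if_neg (by omega)]

open Classical in
lemma lastNeg_succ :
    lastNeg d g c (t + 1) = if IsNegTurn d g t ∧ d t = c then t else lastNeg d g c t := by
  split_ifs with h
  · have : IsGreatest {r | IsNegTurn d g r ∧ d r = c ∧ r < t + 1} t :=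
      ⟨⟨h.1, h.2, t.lt_succ_self⟩, fun r hr ↦ Nat.lt_succ_iff.1 hr.2.2⟩
    exact this.csSup_eq
  · refine congrArg sSup (Set.ext fun r ↦ ?_)
    simp only [Set.mem_ofPred_eq]
    grind

lemma isGreatest_lastNeg (h : {r | IsNegTurn d g r ∧ d r = c ∧ r < t}.Nonempty) :
    IsGreatest {r | IsNegTurn d g r ∧ d r = c ∧ r < t} (lastNeg d g c t) :=
  have hbdd : BddAbove {r | IsNegTurn d g r ∧ d r = c ∧ r < t} := ⟨t, fun _ hr ↦ hr.2.2.le⟩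
  ⟨Nat.sSup_mem h hbdd, fun _ hr ↦ le_csSup hbdd hr⟩

lemma lastNeg_eq_zero (h : {r | IsNegTurn d g r ∧ d r = c ∧ r < t} = ∅) :
    lastNeg d g c t = 0 := by
  rw [lastNeg, h, csSup_empty]; rfl

lemma lastNeg_mem (h : 1 ≤ lastNeg d g c t) :
    IsNegTurn d g (lastNeg d g c t) ∧ d (lastNeg d g c t) = c ∧ lastNeg d g c t < t := by
  obtain he | hne := Set.eq_empty_or_nonempty {r | IsNegTurn d g r ∧ d r = c ∧ r < t}
  · simp [lastNeg_eq_zero he] at h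
  · exact (isGreatest_lastNeg hne).1

lemma lastNeg_lt (ht : 1 ≤ t) : lastNeg d g c t < t := by
  by_cases h : 1 ≤ lastNeg d g c t
  · exact (lastNeg_mem h).2.2
  · omega

lemma apply_lastNeg (h : 1 ≤ lastNeg d g c t) : d (lastNeg d g c t) = c := (lastNeg_mem h).2.1

lemma isLeast_pathEnd (hm : 1 ≤ m) :
    IsLeast {u | HasType d m c u ∧ lastNeg d g (!c) m < u} (pathEnd d g m c) :=
  isLeast_firstOfType apply_lastNeg (lastNeg_lt hm)

lemma pathEnd_one : pathEnd d g 1 c = 1 := by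
  obtain ⟨⟨hu, -⟩, -⟩ := isLeast_pathEnd (d := d) (g := g) (c := c) le_rfl
  exact le_antisymm hu.2.1 hu.1

open Classical in
lemma pathEnd_succ (hm : 1 ≤ m) :
    pathEnd d g (m + 1) c =
      if d m = !c ∧ (IsNegTurn d g m ∨ pathEnd d g m c = m) then m + 1 else pathEnd d g m c := by
  have key := firstOfType_succ (c := c) (apply_lastNeg (d := d) (g := g)) (lastNeg_lt hm)
  have self := firstOfType_succ_self (d := d) (r := m) (c := c)
  unfold pathEnd
  rw [lastNeg_succ]
  grind

lemma lowerEnd_succ_self : lowerEnd d g (k + 1) k = k + 1 :=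
  if_neg fun h ↦ h.2.1.false

open Classical in
lemma lowerEnd_succ (hk : 1 ≤ k) (hkm : k < m) :
    lowerEnd d g (m + 1) k =
      if lowerEnd d g m k = m ∧ d m = (!d k) ∧ ¬ IsNegTurn d g m then m + 1
      else lowerEnd d g m k := by
  have hg := Int.units_eq_one_or (g (k + 1))
  by_cases turn : IsTurn d (k + 1) ∧ g (k + 1) = 1
  · have hd : 1 ≤ k + 1 → d (k + 1) = !d k := by grind [IsTurn]
    obtain rfl | hkm : k + 1 = m ∨ k + 1 < m := by omega
    · have hneg : ¬ IsNegTurn d g (k + 1) := fun h ↦ absurd (turn.2.symm.trans h.2) (by decide)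
      rw [lowerEnd_succ_self, lowerEnd, if_pos ⟨turn.1, by omega, turn.2⟩,
        firstOfType_succ_self hd, if_pos ⟨rfl, hd (by omega), hneg⟩]
    · have hfirst := (isLeast_firstOfType hd hkm).1.1
      simp only [lowerEnd, firstOfType_succ hd hkm, turn, hkm, hkm.trans m.lt_succ_self, true_and,
        if_true]
      grind [IsNegTurn, IsTurn, HasType]
  · have : lowerEnd d g (m + 1) k = k + 1 := if_neg fun h ↦ turn ⟨h.1, h.2.2⟩
    have : lowerEnd d g m k = k + 1 := if_neg fun h ↦ turn ⟨h.1, h.2.2⟩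
    grind [IsNegTurn, IsTurn]

lemma upperEnd_le (hk : 1 ≤ k) : upperEnd d g k ≤ k := by
  unfold upperEnd
  split_ifs
  · exact (isLeast_pathEnd hk).1.1.2.1
  · rfl

lemma lowerEnd_le (hkm : k < m) : lowerEnd d g m k ≤ m := by
  unfold lowerEnd
  split_ifs with h
  · exact (isLeast_firstOfType (fun _ ↦ by grind [IsTurn]) h.2.1).1.1.2.1
  · exact hkm

lemma straightArc_not : StraightArc d g m (!c) i j ↔ StraightArc d g m c j i := by
  simp only [StraightArc]
  refine exists_congr fun k ↦ ?_
  rcases Bool.eq_or_eq_not (d k) c with h | h <;> simp [h, and_comm]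

lemma straightArc_succ_of_isNegTurn (hm : 1 ≤ m) (hc : d m = !c) (h : IsNegTurn d g m) :
    StraightArc d g (m + 1) c i j ↔
      (i = m + 1 ∧ j = pathEnd d g m c) ∨ StraightArc d g m c i j := by
  have hold {k} (h1 : 1 ≤ k) (hkm : k < m) : lowerEnd d g (m + 1) k = lowerEnd d g m k := by
    rw [lowerEnd_succ h1 hkm, if_neg (by tauto)]
  have hnew : upperEnd d g m = pathEnd d g m c := by rw [upperEnd, if_pos h, hc, Bool.not_not]
  have hlow : lowerEnd d g (m + 1) m = m + 1 := lowerEnd_succ_self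
  unfold StraightArc
  constructor
  · rintro ⟨k, h1, hkm, hk⟩
    obtain rfl | hkm := (Nat.lt_succ_iff.1 hkm).eq_or_lt
    · grind
    · exact .inr ⟨k, h1, hkm, by rwa [hold h1 hkm] at hk⟩
  · rintro (⟨rfl, rfl⟩ | ⟨k, h1, hkm, hk⟩)
    · exact ⟨m, hm, m.lt_succ_self, by grind⟩
    · exact ⟨k, h1, by omega, by rwa [hold h1 hkm]⟩

lemma straightArc_succ_of_not_isNegTurn (hm : 1 ≤ m) (hc : d m = !c) (h : ¬ IsNegTurn d g m) :
    StraightArc d g (m + 1) c i j ↔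
      (StraightArc d g m c i j ∧ j ≠ m) ∨ (StraightArc d g m c i m ∧ j = m + 1) ∨
        (i = m + 1 ∧ j = m) := by
  have hlow {k} (h1 : 1 ≤ k) (hkm : k < m) := lowerEnd_succ (d := d) (g := g) h1 hkm
  have hupp {k} (h1 : 1 ≤ k) := upperEnd_le (d := d) (g := g) h1
  have hnew : upperEnd d g m = m := if_neg h
  have hself : lowerEnd d g (m + 1) m = m + 1 := lowerEnd_succ_self
  unfold StraightArc
  constructor
  · rintro ⟨k, h1, hkm, hk⟩
    obtain rfl | hkm := (Nat.lt_succ_iff.1 hkm).eq_or_lt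
    · grind
    · specialize hlow h1 hkm
      specialize hupp h1
      have := lowerEnd_le (d := d) (g := g) hkm
      have := Bool.eq_or_eq_not (d k) c
      by_cases hjm : j = m + 1
      · refine .inr (.inl ⟨⟨k, h1, hkm, by grind⟩, hjm⟩)
      · refine .inl ⟨⟨k, h1, hkm, by grind⟩, by grind⟩
  · rintro (⟨⟨k, h1, hkm, hk⟩, hj⟩ | ⟨⟨k, h1, hkm, hk⟩, rfl⟩ | ⟨hi, hj⟩)
    · have := Bool.eq_or_eq_not (d k) c
      exact ⟨k, h1, by omega, by grind⟩
    · exact ⟨k, h1, by omega, by grind⟩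
    · exact ⟨m, hm, m.lt_succ_self, by grind⟩

/-- The list `l` enumerates the straightening of `1 — 2 — ⋯ — m`, from its starting point to its
finishing point (`c = true`) or backwards (`c = false`). -/
structure IsStraightList (d : ℕ → Bool) (g : ℕ → ℤˣ) (m : ℕ) (c : Bool) (l : List ℕ) : Prop where
  perm : l.Perm (List.range' 1 m)
  arc_iff i j : StraightArc d g m c i j ↔ [i, j] <:+: l
  head? : l.head? = some (pathEnd d g m c)
  getLast? : l.getLast? = some (pathEnd d g m (!c))

namespace IsStraightList

variable {l : List ℕ}

lemma mem_iff (h : IsStraightList d g m c l) : t ∈ l ↔ 1 ≤ t ∧ t ≤ m := by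
  rw [h.perm.mem_iff, List.mem_range'_1]; omega

lemma one : IsStraightList d g 1 c [1] where
  perm := .rfl
  arc_iff i j := by simp [StraightArc, pair_infix_cons_iff]
  head? := by simp [pathEnd_one]
  getLast? := by simp [pathEnd_one]

lemma reverse (h : IsStraightList d g m c l) : IsStraightList d g m (!c) l.reverse where
  perm := (List.reverse_perm l).trans h.perm
  arc_iff i j := by rw [straightArc_not, h.arc_iff, ← List.reverse_infix]; rfl
  head? := by rw [List.head?_reverse, h.getLast?]
  getLast? := by rw [List.getLast?_reverse, h.head?, Bool.not_not]

lemma cons (h : IsStraightList d g m c l) (hm : 1 ≤ m) (hc : d m = !c) (hneg : IsNegTurn d g m) :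
    IsStraightList d g (m + 1) c ((m + 1) :: l) where
  perm := by
    rw [List.range'_1_concat, Nat.add_comm 1 m]
    exact (h.perm.cons _).trans (List.perm_append_singleton _ _).symm
  arc_iff i j := by
    rw [straightArc_succ_of_isNegTurn hm hc hneg, pair_infix_cons_iff, h.head?, h.arc_iff]
    simp [eq_comm]
  head? := by rw [pathEnd_succ hm, if_pos ⟨hc, .inl hneg⟩]; rfl
  getLast? := by
    rw [pathEnd_succ hm, if_neg (by simp [hc])]
    simp [List.getLast?_cons, h.getLast?]

lemma insert {l₁ l₂ : List ℕ} (h : IsStraightList d g m c (l₁ ++ m :: l₂)) (hm : 1 ≤ m)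
    (hc : d m = !c) (hneg : ¬ IsNegTurn d g m) :
    IsStraightList d g (m + 1) c (l₁ ++ (m + 1) :: m :: l₂) where
  perm := by
    rw [List.range'_1_concat, Nat.add_comm 1 m]
    exact List.perm_middle.trans ((h.perm.cons _).trans (List.perm_append_singleton _ _).symm)
  arc_iff i j := by
    have hnodup : (l₁ ++ m :: l₂).Nodup := h.perm.nodup_iff.2 List.nodup_range'
    have hnot := List.nodup_middle.1 hnodup
    rw [straightArc_succ_of_not_isNegTurn hm hc hneg, h.arc_iff, h.arc_iff,
      pair_infix_insert_iff (by grind) (by grind)]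
  head? := by
    have hnodup : (l₁ ++ m :: l₂).Nodup := h.perm.nodup_iff.2 List.nodup_range'
    have hhead := h.head?
    rw [pathEnd_succ hm]
    cases l₁ <;> grind
  getLast? := by
    rw [pathEnd_succ hm, if_neg (by simp [hc])]
    simpa [List.getLast?_append, List.getLast?_cons] using h.getLast?

end IsStraightList

lemma exists_isStraightList (d : ℕ → Bool) (g : ℕ → ℤˣ) (hm : 1 ≤ m) (c : Bool) :
    ∃ l, IsStraightList d g m c l := by
  induction m, hm using Nat.le_induction generalizing c with
  | base => exact ⟨[1], .one⟩
  | succ m hm ih =>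
    obtain ⟨l, hl⟩ : ∃ l, IsStraightList d g (m + 1) (!d m) l := by
      obtain ⟨l, hl⟩ := ih (!d m)
      have hd : d m = !!d m := (Bool.not_not _).symm
      by_cases hneg : IsNegTurn d g m
      · exact ⟨_, hl.cons hm hd hneg⟩
      · obtain ⟨l₁, l₂, rfl⟩ := List.append_of_mem (hl.mem_iff.2 ⟨hm, le_rfl⟩)
        exact ⟨_, hl.insert hm hd hneg⟩
    obtain rfl | rfl := Bool.eq_or_eq_not c (!d m)
    · exact ⟨l, hl⟩
    · exact ⟨_, hl.reverse⟩

lemma StraightArc.snd_mem (h : StraightArc d g m c i j) : 1 ≤ j ∧ j ≤ m := by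
  have hm : 1 ≤ m := by obtain ⟨k, hk, hkm, -⟩ := h; omega
  obtain ⟨l, hl⟩ := exists_isStraightList d g hm c
  exact hl.mem_iff.1 (((hl.arc_iff i j).1 h).subset (by simp))

lemma not_straightArc_pathEnd (hm : 1 ≤ m) : ¬ StraightArc d g m c i (pathEnd d g m c) := by
  obtain ⟨l, hl⟩ := exists_isStraightList d g hm c
  obtain ⟨l, rfl⟩ := List.head?_eq_some_iff.1 hl.head?
  rw [hl.arc_iff]
  exact not_pair_infix_cons_self (List.nodup_cons.1 (hl.perm.nodup_iff.2 List.nodup_range')).1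

end OrientedPath

section OrientedPathEnds

variable {d : ℕ → Bool} {g : ℕ → ℤˣ} {m r s t u : ℕ} {c : Bool}

lemma HasType.of_lt (h : HasType d t c u) (hut : u < t) (htm : t ≤ m) : HasType d m c u :=
  ⟨h.1, by omega, h.2.2.1, fun _ ↦ h.2.2.2 hut⟩

lemma firstOfType_lt (hr : 1 ≤ r → d r = !c) (hrt : r < t) (ht : 2 ≤ t) (hd : d (t - 1) = c) :
    firstOfType d t c r < t := by
  obtain ⟨-, hle, htype, -⟩ := (isLeast_firstOfType hr hrt).1.1
  refine hle.lt_of_ne fun h ↦ ?_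
  rw [h, hd] at htype
  exact Bool.self_ne_not c (htype ht)

lemma exists_hasType_between (hr : 1 ≤ r → d r = !c) (hrt : r < t) (ht : 2 ≤ t)
    (hd : d (t - 1) = c) (htm : t ≤ m) : ∃ u, HasType d m c u ∧ r < u ∧ u < t :=
  have h := (isLeast_firstOfType hr hrt).1
  have hlt := firstOfType_lt hr hrt ht hd
  ⟨_, h.1.of_lt hlt htm, h.2, hlt⟩

lemma isLeast_hasType_firstOfType (hr : 1 ≤ r) (hd : d r = !c) (hrm : r < m) :
    IsLeast {u | (∃ c', HasType d m c' u) ∧ r < u} (firstOfType d m c r) := by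
  obtain ⟨⟨htype, hlt⟩, hmin⟩ := isLeast_firstOfType (fun _ ↦ hd) hrm
  refine ⟨⟨⟨c, htype⟩, hlt⟩, fun u ⟨⟨c', hu⟩, hru⟩ ↦ ?_⟩
  obtain rfl | rfl := Bool.eq_or_eq_not c' c
  · exact hmin ⟨hu, hru⟩
  · obtain ⟨v, hv, hrv, hvu⟩ := exists_hasType_between (fun _ ↦ hd) hru (by omega)
      (by simpa using hu.2.2.1 (by omega)) hu.2.1
    exact (hmin ⟨hv, hrv⟩).trans hvu.le

lemma IsNegTurn.le_lastNeg (h : IsNegTurn d g r) (hrt : r < t) : r ≤ lastNeg d g (d r) t :=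
  le_csSup ⟨t, fun _ hs ↦ hs.2.2.le⟩ ⟨h, rfl, hrt⟩

lemma isLeast_gt_lastNeg_iff {T : Set ℕ} (hT : 0 ∉ T) :
    ((∃ r, IsGreatest {r | IsNegTurn d g r ∧ d r = c ∧ r < t} r ∧ IsLeast {u ∈ T | r < u} s) ∨
      ({r | IsNegTurn d g r ∧ d r = c ∧ r < t} = ∅ ∧ IsLeast T s)) ↔
      IsLeast {u ∈ T | lastNeg d g c t < u} s := by
  obtain he | hne := Set.eq_empty_or_nonempty {r | IsNegTurn d g r ∧ d r = c ∧ r < t}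
  · have hpos : {u ∈ T | 0 < u} = T :=
      Set.sep_eq_self_iff_mem_true.2 fun u hu ↦ Nat.pos_of_ne_zero (ne_of_mem_of_not_mem hu hT)
    simp [he, lastNeg_eq_zero he, hpos, IsGreatest]
  · have hgr := isGreatest_lastNeg hne
    simp only [hne.ne_empty, false_and, or_false]
    exact ⟨fun ⟨r, hr, hs⟩ ↦ hgr.unique hr ▸ hs, fun hs ↦ ⟨_, hgr, hs⟩⟩

lemma firstOfType_lastNeg (ht : IsTurn d t) (hd : d t = !c) (htm : t ≤ m) :
    firstOfType d m c (lastNeg d g (!c) t) = pathEnd d g t c := by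
  have hlt : lastNeg d g (!c) t < t := lastNeg_lt (by have := ht.1; omega)
  exact firstOfType_eq_of_lt apply_lastNeg hlt
    (firstOfType_lt apply_lastNeg hlt ht.1 (Bool.not_inj (ht.2.symm.trans hd))) htm

lemma pathEnd_eq_one_iff (hm : 1 ≤ m) :
    pathEnd d g m c = 1 ↔ HasType d m c 1 ∧ ∀ t < m, IsNegTurn d g t → d t = c := by
  have hleast := isLeast_pathEnd (d := d) (g := g) (c := c) hm
  constructor
  · intro h
    rw [h] at hleast
    refine ⟨hleast.1.1, fun t htm ht ↦ (Bool.eq_or_eq_not (d t) c).resolve_right fun hd ↦ ?_⟩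
    have hle := hd ▸ ht.le_lastNeg htm
    have := hle.trans_lt hleast.1.2
    have := ht.1.1
    omega
  · rintro ⟨htype, hneg⟩
    have hzero : lastNeg d g (!c) m = 0 := by
      by_contra h
      obtain ⟨ht, hd, htm⟩ := lastNeg_mem (Nat.one_le_iff_ne_zero.2 h)
      exact Bool.self_ne_not c ((hneg _ htm ht).symm.trans hd)
    exact (hleast.2 ⟨htype, by omega⟩).antisymm hleast.1.1.1

lemma exists_isGreatest_turn (h : HasType d m c m) (hturn : ∃ t < m, IsTurn d t) :
    ∃ t, IsGreatest {t | t < m ∧ IsTurn d t ∧ d t = !c} t := by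
  suffices h : {t | t < m ∧ IsTurn d t ∧ d t = !c}.Nonempty from
    ⟨_, Nat.sSup_mem h ⟨m, fun t ht ↦ ht.1.le⟩, fun t ht ↦ le_csSup ⟨m, fun t ht ↦ ht.1.le⟩ ht⟩
  obtain ⟨t, htm, ht⟩ := hturn
  obtain hd | hd := Bool.eq_or_eq_not (d t) c
  · obtain ⟨u, hu, htu, hum⟩ := exists_hasType_between (c := !c) (fun _ ↦ by simpa using hd) htm
      (by grind [IsTurn]) (h.2.2.1 (by grind [IsTurn])) le_rfl
    exact ⟨u, hum, by grind [IsTurn, HasType]⟩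
  · exact ⟨t, htm, ht, hd⟩

lemma pathEnd_eq_self_iff (hm : 2 ≤ m) :
    pathEnd d g m c = m ↔ HasType d m c m ∧
      ((∃ t < m, IsTurn d t) →
        ∃ t, IsGreatest {t | t < m ∧ IsTurn d t ∧ d t = !c} t ∧ g t = -1) := by
  have hleast := isLeast_pathEnd (d := d) (g := g) (c := c) (by omega : 1 ≤ m)
  constructor
  · intro h
    rw [h] at hleast
    refine ⟨hleast.1.1, fun hturn ↦ ?_⟩
    obtain ⟨t, ht⟩ := exists_isGreatest_turn hleast.1.1 hturn
    obtain ⟨htm, turn, hd⟩ := ht.1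
    refine ⟨t, ht, by_contra fun hpos ↦ ?_⟩
    have hlast : lastNeg d g (!c) m < t := by
      refine lt_of_not_ge fun hge ↦ ?_
      have := turn.1
      obtain ⟨hneg, hd', hlt⟩ := lastNeg_mem (by omega : 1 ≤ lastNeg d g (!c) m)
      have heq := hge.antisymm' (ht.2 ⟨hlt, hneg.1, hd'⟩)
      exact hpos (heq ▸ hneg.2)
    obtain ⟨u, hu, hru, hut⟩ := exists_hasType_between apply_lastNeg hlast turn.1
      (Bool.not_inj (turn.2.symm.trans hd)) htm.le
    exact absurd (hleast.2 ⟨hu, hru⟩) (by omega)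
  · rintro ⟨htype, hneg⟩
    obtain ⟨⟨hu, hru⟩, -⟩ := hleast
    refine hu.2.1.eq_of_not_lt fun hum ↦ ?_
    obtain ⟨v, hv, huv, hvm⟩ := exists_hasType_between (c := !c)
      (fun _ ↦ by simpa using hu.2.2.2 hum) hum hm (htype.2.2.1 hm) le_rfl
    have turn : IsTurn d v := by grind [IsTurn, HasType]
    obtain ⟨t, ht, hgt⟩ := hneg ⟨v, hvm, turn⟩
    have hvt : v ≤ t := ht.2 ⟨hvm, turn, hv.2.2.2 hvm⟩
    have htneg : IsNegTurn d g t := ⟨ht.1.2.1, hgt⟩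
    have := ht.1.2.2 ▸ htneg.le_lastNeg ht.1.1
    omega

end OrientedPathEnds

section Walks

variable {α : Type*} {σ : Bool → Equiv.Perm α} {w : ℕ → Bool} {x : ℕ → α} {i k m : ℕ}

/-- The walk `x 0, x 1, …` is obtained by applying two involutions alternately, the one applied to
`x k` being `σ (w k)`, and it starts with the pause `x 0 = x 1` at a fixed point of `σ (w 0)`. -/
structure IsAlternatingWalk (σ : Bool → Equiv.Perm α) (w : ℕ → Bool) (x : ℕ → α) : Prop where
  involutive c : Function.Involutive (σ c)
  sign_succ k : w (k + 1) = !w k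
  apply_succ k : x (k + 1) = σ (w k) (x k)
  pause : x 1 = x 0

namespace IsAlternatingWalk

lemma apply_of_succ (h : IsAlternatingWalk σ w x) (k : ℕ) : σ (w k) (x (k + 1)) = x k := by
  rw [h.apply_succ, h.involutive]

lemma sign_add_two_mul (h : IsAlternatingWalk σ w x) (i k : ℕ) : w (i + 2 * k) = w i := by
  induction k with
  | zero => rfl
  | succ k ih => rw [← ih, ← Bool.not_not (w (i + 2 * k)), ← h.sign_succ, ← h.sign_succ]; rfl

lemma pause_of_eq_add_odd (h : IsAlternatingWalk σ w x) (hi : x i = x (i + (2 * k + 1))) :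
    x (i + k + 1) = x (i + k) := by
  induction k generalizing i with
  | zero => exact hi.symm
  | succ k ih =>
    have hstep : x (i + 1) = x (i + 1 + (2 * k + 1)) := by
      have := h.apply_of_succ (i + 2 * (k + 1))
      rw [h.sign_add_two_mul, add_assoc, ← hi, ← h.apply_succ] at this
      exact this.trans (congrArg x (by ring))
    simpa [add_assoc, add_comm 1 k] using ih hstep

lemma pause_of_eq_add_even (h : IsAlternatingWalk σ w x) (hi : x i = x (i + 2 * k)) :
    x (2 * k + 1) = x (2 * k) := by
  induction i with
  | zero =>
    have hw : w (2 * k) = w 0 := by simpa using h.sign_add_two_mul 0 k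
    rw [zero_add] at hi
    rw [h.apply_succ, hw, ← hi, ← h.apply_succ, h.pause]
  | succ i ih =>
    refine ih ?_
    rw [← h.apply_of_succ i, hi, ← h.sign_add_two_mul i k, add_right_comm, h.apply_of_succ]

lemma injOn (h : IsAlternatingWalk σ w x) (hx : ∀ k, 1 ≤ k → k < m → x (k + 1) ≠ x k) :
    Set.InjOn x (Set.Icc 1 m) := by
  suffices hlt : ∀ i j, 1 ≤ i → i < j → j ≤ m → x i ≠ x j from fun i hi j hj hij ↦
    (lt_trichotomy i j).elim (fun h ↦ (hlt i j hi.1 h hj.2 hij).elim) fun h ↦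
      h.resolve_right fun h ↦ hlt j i hj.1 h hi.2 hij.symm
  intro i j hi hij hj hxij
  obtain ⟨d, rfl⟩ := Nat.exists_eq_add_of_lt hij
  obtain ⟨k, rfl | rfl⟩ := Nat.even_or_odd' d
  · exact hx (i + k) (by omega) (by omega) (h.pause_of_eq_add_odd hxij)
  · exact hx (2 * (k + 1)) (by omega) (by omega) (h.pause_of_eq_add_even hxij)

lemma apply_mem_image (h : IsAlternatingWalk σ w x) (hm : x (m + 1) = x m) (c : Bool) {p : α}
    (hp : p ∈ x '' Set.Icc 1 m) : σ c p ∈ x '' Set.Icc 1 m := by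
  obtain ⟨t, ⟨h1, htm⟩, rfl⟩ := hp
  obtain ⟨t, rfl⟩ := Nat.exists_eq_add_of_le' h1
  obtain rfl | hc := Bool.eq_or_eq_not c (w t)
  · rw [h.apply_of_succ]
    obtain rfl | ht := t.eq_zero_or_pos
    · exact ⟨1, ⟨le_rfl, htm⟩, h.pause⟩
    · exact ⟨t, ⟨ht, by omega⟩, rfl⟩
  · rw [hc, ← h.sign_succ, ← h.apply_succ]
    obtain rfl | ht := htm.eq_or_lt
    · exact ⟨t + 1, ⟨h1, le_rfl⟩, hm.symm⟩
    · exact ⟨t + 2, ⟨by omega, ht⟩, rfl⟩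

lemma exists_pause (h : IsAlternatingWalk σ w x) {E : Set α} (hE : E.Finite)
    (hx : ∀ k, x k ∈ E) : ∃ m, 1 ≤ m ∧ x (m + 1) = x m := by
  by_contra! hne
  refine absurd (Set.ncard_le_ncard_of_injOn x (fun k _ ↦ hx k)
    (h.injOn (m := E.ncard + 1) fun k hk _ ↦ hne k hk) hE) ?_
  simp

end IsAlternatingWalk

end Walks

section EdgeWalks

variable {σ : Bool → Equiv.Perm ℤ} {E : Set ℤ} {a : ℤ}

/-- The walk `x` passes once through each point of `E` at the times `1, …, m`, and then pauses
again, so that `x 1` and `x m` are the two end points of the edge `E`. -/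
structure IsEdgeWalk (σ : Bool → Equiv.Perm ℤ) (E : Set ℤ) (m : ℕ) (w : ℕ → Bool) (x : ℕ → ℤ) :
    Prop extends IsAlternatingWalk σ w x where
  two_le : 2 ≤ m
  last_pause : x (m + 1) = x m
  bijOn : Set.BijOn x (Set.Icc 1 m) E

lemma IsMeander.apply_mem (hE : IsMeander (σ true) (σ false) E) (c : Bool) {p : ℤ} (hp : p ∈ E) :
    σ c p ∈ E := by
  obtain ⟨x, rfl⟩ := hE
  have hc : σ c ∈ Subgroup.closure {σ true, σ false} :=
    Subgroup.subset_closure (by cases c <;> simp)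
  exact MulAction.mem_orbit_of_mem_orbit (⟨σ c, hc⟩ : Subgroup.closure {σ true, σ false}) hp

open scoped Pointwise in
lemma IsMeander.subset (hE : IsMeander (σ true) (σ false) E) (hσ : ∀ c, Function.Involutive (σ c))
    (ha : a ∈ E) {S : Set ℤ} (haS : a ∈ S) (hS : ∀ c, Set.MapsTo (σ c) S S) : E ⊆ S := by
  obtain ⟨x, rfl⟩ := hE
  have hle : Subgroup.closure {σ true, σ false} ≤ MulAction.stabilizer (Equiv.Perm ℤ) S := by
    have (c : Bool) : σ c ∈ MulAction.stabilizer (Equiv.Perm ℤ) S :=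
      (hS c).image_subset.antisymm fun p hp ↦ ⟨σ c p, hS c hp, hσ c p⟩
    rw [Subgroup.closure_le]
    rintro _ (rfl | rfl) <;> exact this _
  rw [← MulAction.orbit_eq_iff.2 ha]
  rintro _ ⟨g, rfl⟩
  exact MulAction.mem_stabilizer_iff.1 (hle g.2) ▸ Set.smul_mem_smul_set haS

lemma phi_one : phi σ a 1 = a := by simp [phi, altWord]

lemma exists_isAlternatingWalk_phi (hσ : ∀ c, Function.Involutive (σ c))
    (ha : σ true a = a ∨ σ false a = a) : ∃ w, IsAlternatingWalk σ w (phi σ a) := by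
  classical
  refine ⟨fun k ↦ if Even k then decide (σ true a = a) else !decide (σ true a = a), hσ,
    fun k ↦ ?_, fun k ↦ ?_, by simp [phi]⟩
  · by_cases hk : Even k <;> simp [hk, Nat.even_add_one]
  · cases k with
    | zero => by_cases h : σ true a = a <;> simp_all [phi, altWord]
    | succ k =>
      by_cases h : σ true a = a <;> by_cases hk : Even k <;>
        simp [phi, altWord, h, hk, Nat.even_add_one]

lemma exists_isEdgeWalk_phi (hσ : ∀ c, Function.Involutive (σ c))
    (hE : IsMeander (σ true) (σ false) E) (hE1 : 1 < E.ncard) (ha : a ∈ E)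
    (ha' : σ true a = a ∨ σ false a = a) : ∃ w, IsEdgeWalk σ E E.ncard w (phi σ a) := by
  classical
  obtain ⟨w, hw⟩ := exists_isAlternatingWalk_phi hσ ha'
  have hfin : E.Finite := Set.finite_of_ncard_pos (by omega)
  have hmem (k : ℕ) : phi σ a k ∈ E := by
    induction k with
    | zero => simpa [phi, altWord] using ha
    | succ k ih => exact hw.apply_succ k ▸ hE.apply_mem _ ih
  have hpause := hw.exists_pause hfin hmem
  obtain ⟨hm, hlast⟩ := Nat.find_spec hpause
  have hmin {k} (hk : k < Nat.find hpause) := Nat.find_min hpause hk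
  set m := Nat.find hpause
  have hinj : Set.InjOn (phi σ a) (Set.Icc 1 m) := hw.injOn fun k hk hkm h ↦ hmin hkm ⟨hk, h⟩
  have hsub : E ⊆ phi σ a '' Set.Icc 1 m :=
    hE.subset hσ ha ⟨1, ⟨le_rfl, hm⟩, phi_one⟩ fun c _ ↦ hw.apply_mem_image hlast c
  have hbij : Set.BijOn (phi σ a) (Set.Icc 1 m) E := ⟨fun k _ ↦ hmem k, hinj, hsub⟩
  have hcard : E.ncard = m := by
    rw [← hbij.image_eq, hinj.ncard_image, Set.ncard_Icc_nat, Nat.add_sub_cancel]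
  rw [hcard] at hE1 ⊢
  exact ⟨w, hw, hE1, hlast, hbij⟩

end EdgeWalks

section Transfer

variable {σ : Bool → Equiv.Perm ℤ} {E : Set ℤ} {p q : ℤ} {w : ℕ → Bool} {x : ℕ → ℤ}
  {m i j k : ℕ}

/-- The direction of the arc of a walk between `x t` and `x (t + 1)`: it is `true` if the arc
starts at `x t`. -/
def orient (w : ℕ → Bool) (x : ℕ → ℤ) (t : ℕ) : Bool := decide (x t < x (t + 1) ↔ w t = true)

lemma dirArc_iff_exists_sign :
    DirArc σ p q ↔ p ≠ q ∧ ∃ c, σ c p = q ∧ (p < q ↔ c = true) := by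
  simp only [DirArc, Bool.exists_bool]
  grind

namespace IsEdgeWalk

lemma exists_eq (h : IsEdgeWalk σ E m w x) (hp : p ∈ E) : ∃ i, 1 ≤ i ∧ i ≤ m ∧ x i = p := by
  obtain ⟨i, hi, rfl⟩ := h.bijOn.surjOn hp
  exact ⟨i, hi.1, hi.2, rfl⟩

lemma ne_succ (h : IsEdgeWalk σ E m w x) (h1 : 1 ≤ k) (hk : k < m) : x k ≠ x (k + 1) := fun he ↦
  k.succ_ne_self (h.bijOn.injOn ⟨h1, hk.le⟩ ⟨by omega, hk⟩ he).symm

lemma eq_iff (h : IsEdgeWalk σ E m w x) (hi : 1 ≤ i) (him : i ≤ m) (hj : 1 ≤ j) (hjm : j ≤ m) :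
    x i = x j ↔ i = j :=
  h.bijOn.injOn.eq_iff ⟨hi, him⟩ ⟨hj, hjm⟩

lemma dirArc_iff (h : IsEdgeWalk σ E m w x) (hp : p ∈ E) :
    DirArc σ p q ↔ ∃ k, 1 ≤ k ∧ k < m ∧
      if orient w x k = true then p = x k ∧ q = x (k + 1) else p = x (k + 1) ∧ q = x k := by
  rw [dirArc_iff_exists_sign]
  constructor
  · rintro ⟨hne, c, rfl, hc⟩
    obtain ⟨t, h1, htm, rfl⟩ := h.exists_eq hp
    obtain ⟨t, rfl⟩ := Nat.exists_eq_add_of_le' h1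
    obtain rfl | hcw := Bool.eq_or_eq_not c (w t)
    · rw [h.apply_of_succ] at hne hc ⊢
      have ht : t ≠ 0 := fun ht ↦ by simp [ht, h.pause] at hne
      exact ⟨t, by omega, htm, by grind [orient]⟩
    · rw [hcw, ← h.sign_succ, ← h.apply_succ] at hne hc ⊢
      have ht : t + 1 ≠ m := fun ht ↦ by simp [ht, h.last_pause] at hne
      exact ⟨t + 1, h1, by omega, by grind [orient]⟩
  · rintro ⟨k, h1, hkm, hk⟩
    have := h.ne_succ h1 hkm
    have := h.apply_succ k
    have := h.apply_of_succ k
    split_ifs at hk with hd <;> obtain ⟨rfl, rfl⟩ := hk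
    · exact ⟨by tauto, w k, by grind [orient]⟩
    · exact ⟨by tauto, w k, by grind [orient]⟩

lemma dirArc_map_iff (h : IsEdgeWalk σ E m w x) (hi : 1 ≤ i) (him : i ≤ m) (hj : 1 ≤ j)
    (hjm : j ≤ m) :
    DirArc σ (x i) (x j) ↔
      (j = i + 1 ∧ orient w x i = true) ∨ (i = j + 1 ∧ orient w x j = false) := by
  rw [h.dirArc_iff (h.bijOn.mapsTo ⟨hi, him⟩)]
  constructor
  · rintro ⟨k, h1, hkm, hk⟩
    split_ifs at hk with hd
    · rw [h.eq_iff hi him h1 hkm.le, h.eq_iff hj hjm (by omega) hkm] at hk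
      grind
    · rw [h.eq_iff hi him (by omega) hkm, h.eq_iff hj hjm h1 hkm.le] at hk
      grind
  · rintro (⟨rfl, hd⟩ | ⟨rfl, hd⟩)
    · exact ⟨i, hi, hjm, by simp [hd]⟩
    · exact ⟨j, hj, him, by simp [hd]⟩

lemma dirArc_succ_iff (h : IsEdgeWalk σ E m w x) (hk : 1 ≤ k) (hkm : k < m) :
    DirArc σ (x k) (x (k + 1)) ↔ orient w x k = true := by
  rw [h.dirArc_map_iff hk hkm.le (by omega) hkm]
  grind

lemma dirArc_succ_self_iff (h : IsEdgeWalk σ E m w x) (hk : 1 ≤ k) (hkm : k < m) :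
    DirArc σ (x (k + 1)) (x k) ↔ orient w x k = false := by
  rw [h.dirArc_map_iff (by omega) hkm hk hkm.le]
  grind

end IsEdgeWalk

end Transfer

section Straightening

variable {σ : Bool → Equiv.Perm ℤ} {E : Set ℤ} {a p q : ℤ} {w : ℕ → Bool} {x : ℕ → ℤ}
  {m i j k s t : ℕ} {c : Bool} {sg : ℕ → ℤˣ}

namespace IsEdgeWalk

lemma sign_sub_ne_iff (h : IsEdgeWalk σ E m w x) (h1 : 1 ≤ t) (htm : t + 1 < m) :
    Int.sign (x (t + 1) - x t) ≠ Int.sign (x (t + 1) - x (t + 2)) ↔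
      orient w x (t + 1) = !orient w x t := by
  have hs := h.sign_succ t
  unfold orient
  rcases lt_or_gt_of_ne (h.ne_succ h1 (by omega)) with hl | hl <;>
    rcases lt_or_gt_of_ne (h.ne_succ (by omega : 1 ≤ t + 1) htm) with hr | hr <;>
    grind [Int.sign_eq_one_of_pos, Int.sign_eq_neg_one_of_neg]

lemma mem_internalTP_iff (h : IsEdgeWalk σ E m w (phi σ a)) :
    t ∈ internalTP σ a m ↔ IsTurn (orient w (phi σ a)) t ∧ t < m := by
  have hm := h.two_le
  have hlt : t ≤ m - 1 ↔ t < m := by omega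
  simp only [internalTP, IsTurn, Set.mem_ofPred_eq, and_assoc, hlt]
  refine and_congr_right fun ht ↦ ?_
  rw [and_comm]
  refine and_congr_left fun htm ↦ ?_
  obtain ⟨t, rfl⟩ := Nat.exists_eq_add_of_le' (by omega : 1 ≤ t)
  exact h.sign_sub_ne_iff (by omega) htm

lemma mem_of_dirArc (h : IsEdgeWalk σ E m w x) (hpq : DirArc σ p q) (hq : q ∈ E) : p ∈ E := by
  obtain ⟨-, c, rfl, -⟩ := dirArc_iff_exists_sign.1 hpq
  rw [← h.bijOn.image_eq] at hq ⊢
  simpa [h.involutive c p] using h.apply_mem_image h.last_pause c hq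

lemma forall_dirArc_iff (h : IsEdgeWalk σ E m w x) (h1 : 1 ≤ t) (htm : t ≤ m) :
    (∀ p q, DirArc σ p q → (p = x t ∨ q = x t) → (if c = true then p else q) = x t) ↔
      (2 ≤ t → orient w x (t - 1) = !c) ∧ (t < m → orient w x t = c) := by
  have ht : x t ∈ E := h.bijOn.mapsTo ⟨h1, htm⟩
  constructor
  · intro hall
    have key {k} (hk : 1 ≤ k) (hkm : k < m) (hkt : k = t ∨ k + 1 = t) :
        (orient w x k = c ∧ k = t) ∨ (orient w x k = (!c) ∧ k + 1 = t) := by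
      have := h.eq_iff hk hkm.le h1 htm
      have := h.eq_iff (by omega : 1 ≤ k + 1) hkm h1 htm
      have := h.dirArc_map_iff hk hkm.le (by omega : 1 ≤ k + 1) hkm
      have := h.dirArc_map_iff (by omega : 1 ≤ k + 1) hkm hk hkm.le
      have := hall (x k) (x (k + 1))
      have := hall (x (k + 1)) (x k)
      grind
    exact ⟨fun h2 ↦ by grind, fun hlt ↦ by grind⟩
  · rintro ⟨hl, hr⟩ p q hpq hor
    have hp : p ∈ E := hor.elim (fun e ↦ e ▸ ht) fun e ↦ h.mem_of_dirArc hpq (e ▸ ht)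
    obtain ⟨k, hk, hkm, hk'⟩ := (h.dirArc_iff hp).1 hpq
    have := h.eq_iff hk hkm.le h1 htm
    have := h.eq_iff (by omega : 1 ≤ k + 1) hkm h1 htm
    grind

lemma mem_TP_iff (h : IsEdgeWalk σ E m w (phi σ a)) :
    t ∈ TP σ a m c ↔ HasType (orient w (phi σ a)) m c t := by
  have : t ∈ TP σ a m c ↔ t ∈ turningPoints σ a m ∧ ∀ p q, DirArc σ p q →
      (p = phi σ a t ∨ q = phi σ a t) → (if c = true then p else q) = phi σ a t := by
    cases c <;> simp [TP]
  rw [this, turningPoints, Set.mem_union, h.mem_internalTP_iff]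
  have := h.two_le
  have := h.forall_dirArc_iff (t := t) (c := c)
  grind [HasType, IsTurn]

lemma mem_turningPoints_iff (h : IsEdgeWalk σ E m w (phi σ a)) :
    t ∈ turningPoints σ a m ↔ ∃ c, HasType (orient w (phi σ a)) m c t := by
  rw [turningPoints, Set.mem_union, h.mem_internalTP_iff]
  have := h.two_le
  constructor
  · rintro ((rfl | rfl) | ⟨ht, htm⟩)
    · exact ⟨orient w (phi σ a) 1, by grind [HasType]⟩
    · exact ⟨!orient w (phi σ a) (t - 1), by grind [HasType]⟩
    · exact ⟨orient w (phi σ a) t, by grind [HasType, IsTurn]⟩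
  · grind [HasType, IsTurn]

lemma mem_negTP_iff (h : IsEdgeWalk σ E m w (phi σ a)) :
    t ∈ negTP σ a m sg c ↔
      IsNegTurn (orient w (phi σ a)) sg t ∧ orient w (phi σ a) t = c ∧ t < m := by
  simp only [negTP, Set.mem_ofPred_eq, h.mem_internalTP_iff, h.mem_TP_iff]
  grind [IsNegTurn, IsTurn, HasType]

lemma crosses_iff (h : IsEdgeWalk σ E m w (phi σ a)) (ht : IsTurn (orient w (phi σ a)) t)
    (htm : t < m) (hc : orient w (phi σ a) t = c) :
    Crosses σ a m sg c t s ↔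
      (sg t = 1 ∧ s = firstOfType (orient w (phi σ a)) m (!c) t) ∨
        (sg t = -1 ∧ s = pathEnd (orient w (phi σ a)) sg t (!c)) := by
  set d := orient w (phi σ a)
  have hTP : TP σ a m (!c) = {u | HasType d m (!c) u} := Set.ext fun _ ↦ h.mem_TP_iff
  have hneg : {r ∈ negTP σ a m sg c | r < t} = {r | IsNegTurn d sg r ∧ d r = c ∧ r < t} := by
    ext r
    simp only [Set.mem_ofPred_eq, h.mem_negTP_iff]
    exact ⟨fun hr ↦ ⟨hr.1.1, hr.1.2.1, hr.2⟩, fun hr ↦ ⟨⟨hr.1, hr.2.1, hr.2.2.trans htm⟩, hr.2.2⟩⟩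
  have hlt : lastNeg d sg c t < t := lastNeg_lt (by have := ht.1; omega)
  have hpath : firstOfType d m (!c) (lastNeg d sg c t) = pathEnd d sg t (!c) := by
    simpa using firstOfType_lastNeg (g := sg) ht (c := !c) (by simpa using hc) htm.le
  have hzero : 0 ∉ TP σ a m (!c) := by simp [hTP, HasType]
  simp only [Crosses, hneg, isLeast_gt_lastNeg_iff hzero]
  rw [hTP, ← hpath, eq_comm (a := s), eq_comm (a := s)]
  refine or_congr (and_congr_right' ?_) (and_congr_right' ?_)
  · exact (firstOfType_eq_iff (fun _ ↦ by simpa using hc) htm).symm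
  · exact (firstOfType_eq_iff (fun h ↦ by simpa using apply_lastNeg h) (hlt.trans htm)).symm

lemma not_isNegTurn (h : IsEdgeWalk σ E m w (phi σ a))
    (hsg : Set.InjOn (markedIndex sg) (internalTP σ a m))
    (ht : IsTurn (orient w (phi σ a)) (k + 1)) (hk : k + 1 < m) (hpos : sg (k + 1) = 1) :
    ¬ IsNegTurn (orient w (phi σ a)) sg k := fun hneg ↦ by
  have := hsg (h.mem_internalTP_iff.2 ⟨ht, hk⟩) (h.mem_internalTP_iff.2 ⟨hneg.1, by omega⟩)
    (by simp [markedIndex, hpos, hneg.2])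
  omega

lemma ends_of_isNegTurn (h : IsEdgeWalk σ E m w (phi σ a))
    (hsg : Set.InjOn (markedIndex sg) (internalTP σ a m))
    (ht : IsNegTurn (orient w (phi σ a)) sg t) :
    upperEnd (orient w (phi σ a)) sg t =
        pathEnd (orient w (phi σ a)) sg t (!orient w (phi σ a) t) ∧
      lowerEnd (orient w (phi σ a)) sg m t = t + 1 :=
  ⟨if_pos ht, if_neg fun hpos ↦ h.not_isNegTurn hsg hpos.1 hpos.2.1 hpos.2.2 ht⟩

lemma ends_of_isTurn_succ (h : IsEdgeWalk σ E m w (phi σ a))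
    (hsg : Set.InjOn (markedIndex sg) (internalTP σ a m))
    (ht : IsTurn (orient w (phi σ a)) (k + 1)) (hk : k + 1 < m) (hpos : sg (k + 1) = 1) :
    upperEnd (orient w (phi σ a)) sg k = k ∧
      lowerEnd (orient w (phi σ a)) sg m k =
        firstOfType (orient w (phi σ a)) m (!orient w (phi σ a) (k + 1)) (k + 1) := by
  have hd : (!orient w (phi σ a) (k + 1)) = orient w (phi σ a) k := by simp [ht.2]
  exact ⟨if_neg (h.not_isNegTurn hsg ht hk hpos), hd ▸ if_pos ⟨ht, hk, hpos⟩⟩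

lemma ends_of_unmarked (h : IsEdgeWalk σ E m w (phi σ a)) (hk : k < m)
    (hunmarked : ∀ t ∈ internalTP σ a m, markedIndex sg t ≠ k) :
    upperEnd (orient w (phi σ a)) sg k = k ∧ lowerEnd (orient w (phi σ a)) sg m k = k + 1 :=
  ⟨if_neg fun ht ↦ hunmarked k (h.mem_internalTP_iff.2 ⟨ht.1, hk⟩) (by simp [markedIndex, ht.2]),
    if_neg fun ht ↦ hunmarked (k + 1) (h.mem_internalTP_iff.2 ⟨ht.1, ht.2.1⟩)
      (by simp [markedIndex, ht.2.2])⟩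

lemma exists_straightArc_of_starArc (h : IsEdgeWalk σ E m w (phi σ a))
    (hsg : Set.InjOn (markedIndex sg) (internalTP σ a m)) (hpq : StarArc σ a m sg p q) :
    ∃ i j, p = phi σ a i ∧ q = phi σ a j ∧ StraightArc (orient w (phi σ a)) sg m true i j := by
  obtain ⟨k, hk, hkm, hunmarked, hpq, hends⟩ | ⟨t, ht, c, s, htc, hs, hpq⟩ := hpq
  · obtain ⟨hupp, hlow⟩ := h.ends_of_unmarked hkm hunmarked
    obtain ⟨rfl, rfl⟩ | ⟨rfl, rfl⟩ := hends
    · rw [h.dirArc_succ_iff hk hkm] at hpq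
      exact ⟨k, k + 1, rfl, rfl, k, hk, hkm, by grind⟩
    · rw [h.dirArc_succ_self_iff hk hkm] at hpq
      exact ⟨k + 1, k, rfl, rfl, k, hk, hkm, by grind⟩
  · obtain ⟨turn, htm⟩ := h.mem_internalTP_iff.1 ht
    obtain rfl : orient w (phi σ a) t = c := (h.mem_TP_iff.1 htc).2.2.2 htm
    obtain ⟨k, rfl⟩ := Nat.exists_eq_add_of_le' turn.1
    have := turn.2
    obtain ⟨hpos, rfl⟩ | ⟨hneg, rfl⟩ := (h.crosses_iff turn htm rfl).1 hs
    · obtain ⟨hupp, hlow⟩ := h.ends_of_isTurn_succ hsg turn htm hpos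
      have hk : 1 ≤ k + 1 := by omega
      simp only [outerEnd, hpos, if_true, Nat.add_succ_sub_one, h.dirArc_succ_iff hk (by omega),
        h.dirArc_succ_self_iff hk (by omega)] at hpq
      rcases hpq with ⟨harc, rfl, rfl⟩ | ⟨harc, rfl, rfl⟩
      · exact ⟨_, k + 1, rfl, rfl, k + 1, hk, by omega, by grind⟩
      · exact ⟨k + 1, _, rfl, rfl, k + 1, hk, by omega, by grind⟩
    · obtain ⟨hupp, hlow⟩ := h.ends_of_isNegTurn hsg ⟨turn, hneg⟩
      have hne : sg (k + 2) ≠ 1 := by rw [hneg]; decide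
      have hk : 1 ≤ k + 2 := by omega
      simp only [outerEnd, if_neg hne, h.dirArc_succ_iff hk htm,
        h.dirArc_succ_self_iff hk htm] at hpq
      rcases hpq with ⟨harc, rfl, rfl⟩ | ⟨harc, rfl, rfl⟩
      · exact ⟨_, k + 3, rfl, rfl, k + 2, hk, htm, by grind⟩
      · exact ⟨k + 3, _, rfl, rfl, k + 2, hk, htm, by grind⟩

lemma starArc_of_straightArc (h : IsEdgeWalk σ E m w (phi σ a))
    (hsg : Set.InjOn (markedIndex sg) (internalTP σ a m))
    (hij : StraightArc (orient w (phi σ a)) sg m true i j) :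
    StarArc σ a m sg (phi σ a i) (phi σ a j) := by
  obtain ⟨k, hk, hkm, hij⟩ := hij
  by_cases hunmarked : ∀ t ∈ internalTP σ a m, markedIndex sg t ≠ k
  · obtain ⟨hupp, hlow⟩ := h.ends_of_unmarked hkm hunmarked
    have := h.dirArc_succ_iff hk hkm
    have := h.dirArc_succ_self_iff hk hkm
    exact .inl ⟨k, hk, hkm, hunmarked, by grind⟩
  · push Not at hunmarked
    obtain ⟨t, ht, rfl⟩ := hunmarked
    obtain ⟨turn, htm⟩ := h.mem_internalTP_iff.1 ht
    have htc : t ∈ TP σ a m (orient w (phi σ a) t) :=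
      h.mem_TP_iff.2 ⟨by grind [IsTurn], htm.le, by grind [IsTurn], fun _ ↦ rfl⟩
    obtain ⟨k, rfl⟩ := Nat.exists_eq_add_of_le' turn.1
    have := turn.2
    obtain hpos | hneg := Int.units_eq_one_or (sg (k + 2))
    · obtain ⟨hupp, hlow⟩ := h.ends_of_isTurn_succ hsg turn htm hpos
      have := h.dirArc_succ_iff (k := k + 1) (by omega) (by omega)
      have := h.dirArc_succ_self_iff (k := k + 1) (by omega) (by omega)
      refine .inr ⟨k + 2, ht, _, _, htc, (h.crosses_iff turn htm rfl).2 (.inl ⟨hpos, rfl⟩), ?_⟩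
      simp only [markedIndex, outerEnd, if_pos hpos] at hij ⊢
      grind
    · obtain ⟨hupp, hlow⟩ := h.ends_of_isNegTurn hsg ⟨turn, hneg⟩
      have := h.dirArc_succ_iff hk hkm
      have := h.dirArc_succ_self_iff hk hkm
      have hne : sg (k + 2) ≠ 1 := by rw [hneg]; decide
      refine .inr ⟨k + 2, ht, _, _, htc, (h.crosses_iff turn htm rfl).2 (.inr ⟨hneg, rfl⟩), ?_⟩
      simp only [markedIndex, outerEnd, if_neg hne] at *
      grind

lemma starArc_iff (h : IsEdgeWalk σ E m w (phi σ a))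
    (hsg : Set.InjOn (markedIndex sg) (internalTP σ a m)) :
    StarArc σ a m sg p q ↔ ∃ i j, p = phi σ a i ∧ q = phi σ a j ∧
      StraightArc (orient w (phi σ a)) sg m true i j :=
  ⟨h.exists_straightArc_of_starArc hsg, by
    rintro ⟨i, j, rfl, rfl, hij⟩; exact h.starArc_of_straightArc hsg hij⟩

end IsEdgeWalk

end Straightening

section Ends

variable {σ : Bool → Equiv.Perm ℤ} {E : Set ℤ} {a b p q : ℤ} {w : ℕ → Bool} {x : ℕ → ℤ}
  {m i j : ℕ} {c : Bool} {sg : ℕ → ℤˣ} {ψ : ℕ → ℤ} {l : List ℕ}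

lemma bijOn_getD_of_perm_range' (hl : l.Perm (List.range' 1 m)) :
    Set.BijOn (fun k ↦ l.getD (k - 1) 0) (Set.Icc 1 m) (Set.Icc 1 m) := by
  have hlen : l.length = m := by simpa using hl.length_eq
  have hmem (t : ℕ) : t ∈ l ↔ t ∈ Set.Icc 1 m := by
    rw [hl.mem_iff, List.mem_range'_1, Set.mem_Icc]; omega
  have hget {k} (hk : k ∈ Set.Icc 1 m) : ∃ h : k - 1 < l.length, l.getD (k - 1) 0 = l[k - 1] :=
    have h : k - 1 < l.length := by grind
    ⟨h, List.getD_eq_getElem _ _ h⟩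
  refine ⟨fun k hk ↦ ?_, fun j hj k hk hjk ↦ ?_, fun t ht ↦ ?_⟩
  · obtain ⟨h, hk'⟩ := hget hk
    simpa only [hk'] using (hmem _).1 (List.getElem_mem h)
  · obtain ⟨hj₁, hj'⟩ := hget hj
    obtain ⟨hk₁, hk'⟩ := hget hk
    have hnodup : l.Nodup := hl.nodup_iff.2 List.nodup_range'
    have := (hnodup.getElem_inj_iff (hi := hj₁) (hj := hk₁)).1 (hj'.symm.trans (hjk.trans hk'))
    grind
  · obtain ⟨k, hk, rfl⟩ := List.getElem_of_mem ((hmem t).2 ht)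
    exact ⟨k + 1, ⟨by omega, by omega⟩, List.getD_eq_getElem _ _ hk⟩

lemma pair_infix_iff_getD :
    [i, j] <:+: l ↔
      ∃ k, 1 ≤ k ∧ k < l.length ∧ i = l.getD (k - 1) 0 ∧ j = l.getD (k + 1 - 1) 0 := by
  rw [pair_infix_iff_getElem?]
  constructor
  · rintro ⟨k, hi, hj⟩
    exact ⟨k + 1, by grind⟩
  · rintro ⟨k, hk, hkl, hij⟩
    exact ⟨k - 1, by grind⟩

namespace IsEdgeWalk

lemma eq_last_of_fixed (h : IsEdgeWalk σ E m w x) (hb : b ∈ E) (hb1 : b ≠ x 1)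
    (hfix : σ true b = b ∨ σ false b = b) : b = x m := by
  obtain ⟨c, hc⟩ : ∃ c, σ c b = b := (Bool.exists_bool.2 hfix.symm)
  obtain ⟨t, ht, htm, rfl⟩ := h.exists_eq hb
  obtain ⟨t, rfl⟩ := Nat.exists_eq_add_of_le' ht
  by_contra hne
  have htm : t + 1 < m := htm.lt_of_ne fun h ↦ hne (h ▸ rfl)
  have ht0 : t ≠ 0 := fun h ↦ hb1 (h ▸ rfl)
  obtain rfl | rfl := Bool.eq_or_eq_not c (w t)
  · exact h.ne_succ (by omega) (by omega) ((h.apply_of_succ t).symm.trans hc)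
  · rw [← h.sign_succ, ← h.apply_succ] at hc
    exact h.ne_succ ht htm hc.symm

lemma exists_isStraightening (h : IsEdgeWalk σ E E.ncard w (phi σ a))
    (hsg : Set.InjOn (markedIndex sg) (internalTP σ a E.ncard)) :
    ∃ ψ, IsStraightening σ a E sg ψ := by
  obtain ⟨l, hl⟩ :=
    exists_isStraightList (orient w (phi σ a)) sg (one_le_two.trans h.two_le) true
  have hlen : l.length = E.ncard := by simpa using hl.perm.length_eq
  refine ⟨_, h.bijOn.comp (bijOn_getD_of_perm_range' hl.perm), fun p q ↦ ?_⟩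
  simp only [h.starArc_iff hsg, hl.arc_iff, pair_infix_iff_getD, hlen, Function.comp_apply]
  constructor
  · rintro ⟨_, _, rfl, rfl, k, hk, hkm, rfl, rfl⟩
    exact ⟨k, hk, hkm, rfl, rfl⟩
  · rintro ⟨k, hk, hkm, rfl, rfl⟩
    exact ⟨_, _, rfl, rfl, k, hk, hkm, rfl, rfl⟩

lemma pathEnd_mem_TP (h : IsEdgeWalk σ E m w (phi σ a)) :
    pathEnd (orient w (phi σ a)) sg m c ∈ TP σ a m c :=
  h.mem_TP_iff.2 (isLeast_pathEnd (one_le_two.trans h.two_le)).1.1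

lemma one_le_pathEnd (h : IsEdgeWalk σ E m w (phi σ a)) :
    1 ≤ pathEnd (orient w (phi σ a)) sg m c :=
  (h.mem_TP_iff.1 h.pathEnd_mem_TP).1

lemma pathEnd_le (h : IsEdgeWalk σ E m w (phi σ a)) :
    pathEnd (orient w (phi σ a)) sg m c ≤ m :=
  (h.mem_TP_iff.1 h.pathEnd_mem_TP).2.1

lemma apply_pathEnd_ne (h : IsEdgeWalk σ E m w (phi σ a))
    (hij : StraightArc (orient w (phi σ a)) sg m c i j) :
    phi σ a (pathEnd (orient w (phi σ a)) sg m c) ≠ phi σ a j := by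
  have hm : 1 ≤ m := one_le_two.trans h.two_le
  obtain ⟨hj, hjm⟩ := hij.snd_mem
  rw [ne_eq, h.eq_iff h.one_le_pathEnd h.pathEnd_le hj hjm]
  rintro rfl
  exact not_straightArc_pathEnd hm hij

lemma not_starArc_start (h : IsEdgeWalk σ E m w (phi σ a))
    (hsg : Set.InjOn (markedIndex sg) (internalTP σ a m)) :
    ¬ StarArc σ a m sg p (phi σ a (pathEnd (orient w (phi σ a)) sg m true)) := fun harc ↦
  have ⟨_, _, _, heq, hij⟩ := (h.starArc_iff hsg).1 harc
  h.apply_pathEnd_ne hij heq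

lemma not_starArc_finish (h : IsEdgeWalk σ E m w (phi σ a))
    (hsg : Set.InjOn (markedIndex sg) (internalTP σ a m)) :
    ¬ StarArc σ a m sg (phi σ a (pathEnd (orient w (phi σ a)) sg m false)) q := fun harc ↦
  have ⟨_, _, heq, _, hij⟩ := (h.starArc_iff hsg).1 harc
  h.apply_pathEnd_ne (straightArc_not.2 hij) heq

lemma exists_eq_apply_pathEnd (h : IsEdgeWalk σ E m w (phi σ a))
    (hψ : Set.BijOn ψ (Set.Icc 1 m) E) (c : Bool) :
    ∃ k, 1 ≤ k ∧ k ≤ m ∧ ψ k = phi σ a (pathEnd (orient w (phi σ a)) sg m c) := by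
  obtain ⟨k, ⟨hk, hkm⟩, heq⟩ := hψ.surjOn (h.bijOn.mapsTo ⟨h.one_le_pathEnd, h.pathEnd_le⟩)
  exact ⟨k, hk, hkm, heq⟩

lemma straightening_start (h : IsEdgeWalk σ E E.ncard w (phi σ a))
    (hsg : Set.InjOn (markedIndex sg) (internalTP σ a E.ncard))
    (hψ : IsStraightening σ a E sg ψ) :
    ψ 1 = phi σ a (pathEnd (orient w (phi σ a)) sg E.ncard true) := by
  obtain ⟨k, hk, hkm, heq⟩ := h.exists_eq_apply_pathEnd (sg := sg) hψ.1 true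
  obtain rfl | hlt := hk.eq_or_lt
  · exact heq
  · obtain ⟨k, rfl⟩ := Nat.exists_eq_add_of_lt hlt
    exact (h.not_starArc_start hsg (heq ▸ (hψ.2 _ _).2 ⟨_, by omega, hkm, rfl, rfl⟩)).elim

lemma straightening_finish (h : IsEdgeWalk σ E E.ncard w (phi σ a))
    (hsg : Set.InjOn (markedIndex sg) (internalTP σ a E.ncard))
    (hψ : IsStraightening σ a E sg ψ) :
    ψ E.ncard = phi σ a (pathEnd (orient w (phi σ a)) sg E.ncard false) := by
  obtain ⟨k, hk, hkm, heq⟩ := h.exists_eq_apply_pathEnd (sg := sg) hψ.1 false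
  obtain rfl | hlt := hkm.eq_or_lt
  · exact heq
  · exact (h.not_starArc_finish hsg (heq ▸ (hψ.2 _ _).2 ⟨k, hk, hlt, rfl, rfl⟩)).elim

lemma setOf_isNegTurn_eq (h : IsEdgeWalk σ E m w (phi σ a)) :
    {r | IsNegTurn (orient w (phi σ a)) sg r ∧ orient w (phi σ a) r = c ∧ r < m} =
      negTP σ a m sg c :=
  Set.ext fun _ ↦ h.mem_negTP_iff.symm

lemma pathEnd_of_negTP_nonempty (h : IsEdgeWalk σ E m w (phi σ a))
    (hne : (negTP σ a m sg (!c)).Nonempty) :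
    ∃ r s, IsGreatest (negTP σ a m sg (!c)) r ∧ IsLeast {u ∈ turningPoints σ a m | r < u} s ∧
      s ∈ TP σ a m c ∧
        phi σ a (pathEnd (orient w (phi σ a)) sg m c) = phi σ a s := by
  rw [← h.setOf_isNegTurn_eq] at hne ⊢
  have hr := isGreatest_lastNeg hne
  obtain ⟨hneg, hd, hlt⟩ := hr.1
  have hleast := isLeast_hasType_firstOfType (one_le_two.trans hneg.1.1) hd hlt
  exact ⟨_, _, hr, by simp only [h.mem_turningPoints_iff]; exact hleast, h.pathEnd_mem_TP, rfl⟩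

lemma pathEnd_of_negTP_eq_empty (h : IsEdgeWalk σ E m w (phi σ a))
    (he : negTP σ a m sg (!c) = ∅) :
    ∃ s, IsLeast (TP σ a m c) s ∧
      phi σ a (pathEnd (orient w (phi σ a)) sg m c) = phi σ a s := by
  rw [← h.setOf_isNegTurn_eq] at he
  have hleast := isLeast_pathEnd (d := orient w (phi σ a)) (g := sg) (c := c)
    (one_le_two.trans h.two_le)
  exact ⟨_, ⟨h.pathEnd_mem_TP, fun u hu ↦ hleast.2 ⟨h.mem_TP_iff.1 hu, by
    rw [lastNeg_eq_zero he]; exact (h.mem_TP_iff.1 hu).1⟩⟩, rfl⟩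

lemma mem_image_TP_iff (h : IsEdgeWalk σ E m w (phi σ a)) (hj : 1 ≤ j) (hjm : j ≤ m) :
    phi σ a j ∈ phi σ a '' TP σ a m c ↔ HasType (orient w (phi σ a)) m c j := by
  rw [← h.mem_TP_iff]
  refine ⟨?_, Set.mem_image_of_mem _⟩
  rintro ⟨t, ht, heq⟩
  obtain ⟨ht1, htm, -⟩ := h.mem_TP_iff.1 ht
  rwa [(h.eq_iff ht1 htm hj hjm).1 heq] at ht

lemma pathEnd_eq_first_iff (h : IsEdgeWalk σ E m w (phi σ a)) :
    phi σ a (pathEnd (orient w (phi σ a)) sg m c) = a ↔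
      a ∈ phi σ a '' TP σ a m c ∧ negTP σ a m sg (!c) = ∅ := by
  have hm : 1 ≤ m := one_le_two.trans h.two_le
  have hfirst : phi σ a (pathEnd (orient w (phi σ a)) sg m c) = a ↔
      pathEnd (orient w (phi σ a)) sg m c = 1 := by
    rw [← h.eq_iff h.one_le_pathEnd h.pathEnd_le le_rfl hm, phi_one]
  have hmem : a ∈ phi σ a '' TP σ a m c ↔ HasType (orient w (phi σ a)) m c 1 := by
    rw [← h.mem_image_TP_iff le_rfl hm, phi_one]
  rw [hfirst, pathEnd_eq_one_iff hm, hmem, Set.eq_empty_iff_forall_notMem]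
  refine and_congr_right' (forall_congr' fun t ↦ ?_)
  rw [h.mem_negTP_iff]
  grind

lemma pathEnd_eq_last_iff (h : IsEdgeWalk σ E m w (phi σ a)) :
    phi σ a (pathEnd (orient w (phi σ a)) sg m c) = phi σ a m ↔
      phi σ a m ∈ phi σ a '' TP σ a m c ∧ ((internalTP σ a m).Nonempty →
        ∃ r, IsGreatest (internalTP σ a m ∩ TP σ a m (!c)) r ∧ sg r = -1) := by
  have hm : 1 ≤ m := one_le_two.trans h.two_le
  have hset : {t | t < m ∧ IsTurn (orient w (phi σ a)) t ∧ orient w (phi σ a) t = !c} =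
      internalTP σ a m ∩ TP σ a m (!c) := by
    ext t
    simp only [Set.mem_ofPred_eq, Set.mem_inter_iff, h.mem_internalTP_iff, h.mem_TP_iff]
    grind [IsTurn, HasType]
  have hex : (∃ t < m, IsTurn (orient w (phi σ a)) t) ↔ (internalTP σ a m).Nonempty :=
    exists_congr fun t ↦ by rw [h.mem_internalTP_iff, and_comm]
  rw [h.eq_iff h.one_le_pathEnd h.pathEnd_le hm le_rfl, pathEnd_eq_self_iff h.two_le,
    h.mem_image_TP_iff hm le_rfl, hset, hex]

end IsEdgeWalk

end Ends

section AntiToeplitz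

variable {n : ℕ} {P : DoublePartition n} {lo hi r s x y : ℤ} {M : Set ℤ}

lemma kappa_apply (hlo : lo ≤ x) (hhi : x ≤ hi) : kappa lo hi x = lo + hi - x :=
  if_pos ⟨hlo, hhi⟩

lemma leftHalf_bounds (hrs : IsMarkedInterval lo hi M r s) (hy : y ∈ leftHalf lo hi r s) :
    lo ≤ y ∧ 2 * y ≤ lo + hi := by
  obtain ⟨hr, -, hs, -⟩ := hrs
  unfold leftHalf at hy
  unfold lastArc at hs hy
  split_ifs at hy with h
  · obtain ⟨hry, hys⟩ := hy
    omega
  · obtain ⟨hry, hys⟩ := hy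
    rw [Int.even_iff] at h
    omega

lemma image_leftHalf_bounds (hrs : IsMarkedInterval lo hi M r s)
    (hy : y ∈ kappa lo hi '' leftHalf lo hi r s) : lo + hi ≤ 2 * y := by
  obtain ⟨z, hz, rfl⟩ := hy
  obtain ⟨hlo, hhi⟩ := leftHalf_bounds hrs hz
  rw [kappa_apply hlo (by omega)]
  omega

lemma IsAntiToeplitz.bounds {σ : Equiv.Perm ℤ} (h : IsAntiToeplitz lo hi M σ) (hlo : lo ≤ x)
    (hhi : x ≤ hi) : (x < σ x → 2 * x ≤ lo + hi) ∧ (σ x < x → lo + hi ≤ 2 * x) := by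
  by_cases hx : ∃ r s, IsMarkedInterval lo hi M r s ∧ x ∈ extended lo hi r s
  · obtain ⟨r, s, hrs, hx⟩ := hx
    obtain hfix | hne := eq_or_ne (σ x) x
    · simp [hfix]
    · obtain ⟨hl, hr⟩ | ⟨hl, hr⟩ := (h.1 r s hrs).2.2 x hx hne
      all_goals
        have := leftHalf_bounds hrs hl
        have := image_leftHalf_bounds hrs hr
        omega
  · push Not at hx
    rw [h.2 x hlo hhi hx, kappa_apply hlo hhi]
    omega

lemma DoublePartition.exists_isComponent_of_simpleRoots {c : Bool} (hxy : x < y)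
    (h : ∀ k, x ≤ k → k < y → k ∈ P.simpleRoots c) :
    ∃ lo hi, P.IsComponent c lo hi ∧ lo ≤ x ∧ y ≤ hi := by
  induction y, Int.add_one_le_of_lt hxy using Int.leInduction with
  | base => exact h x le_rfl hxy
  | succ y hy ih =>
    obtain ⟨lo, hi, hJ, hx, hyhi⟩ := ih (by omega) fun k hxk hky ↦ h k hxk (by omega)
    obtain ⟨lo', hi', hJ', hy', hyhi'⟩ := h y (by omega) (by omega)
    have heq : Finset.Icc lo hi = Finset.Icc lo' hi' :=
      (P.part c).eq_of_mem_parts hJ.2 hJ'.2 (Finset.mem_Icc.2 ⟨by omega, hyhi⟩)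
        (Finset.mem_Icc.2 ⟨hy', by omega⟩)
    have hsucc : y + 1 ∈ Finset.Icc lo hi := heq ▸ Finset.mem_Icc.2 ⟨by omega, hyhi'⟩
    exact ⟨lo, hi, hJ, hx, (Finset.mem_Icc.1 hsucc).2⟩

lemma DoublePartition.exists_isComponent_of_not_isNil (c : Bool) (hx : 1 ≤ x) (hxy : x < y)
    (hy : y ≤ n) (h : ¬ P.IsNil x y) : ∃ lo hi, P.IsComponent c lo hi ∧ lo ≤ x ∧ y ≤ hi := by
  refine exists_isComponent_of_simpleRoots hxy fun k hxk hky ↦ by_contra fun hk ↦ h ?_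
  have hkn : k ∈ Set.Ico (1 : ℤ) n := ⟨by omega, by omega⟩
  refine ⟨k, by omega, by omega, ?_⟩
  cases c
  · exact .inr ⟨hkn, hk⟩
  · exact .inl ⟨hkn, hk⟩

lemma DoublePartition.isNil_comm : P.IsNil x y ↔ P.IsNil y x := by
  rw [IsNil, IsNil, min_comm, max_comm]

lemma DoublePartition.IsModified.isNil {M : Set (Bool × ℤ)} {σ : Bool → Equiv.Perm ℤ}
    (hσ : P.IsModified M σ) {c : Bool} (hxy : x < y) (hx : σ c x < x) (hy : y < σ c y) :
    P.IsNil x y := by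
  by_contra h
  have hmem {z} (hz : σ c z ≠ z) : z ∈ Set.Icc (1 : ℤ) n :=
    by_contra fun hz' ↦ hz ((hσ c).2.1 z hz')
  obtain ⟨lo, hi, hJ, hlo, hhi⟩ :=
    exists_isComponent_of_not_isNil c (hmem hx.ne).1 hxy (hmem hy.ne').2 h
  have hanti := (hσ c).2.2 lo hi hJ
  have := (hanti.bounds hlo (by omega)).2 hx
  have := (hanti.bounds (by omega) hhi).1 hy
  omega

end AntiToeplitz

section Signatures

variable {n : ℕ} {P : DoublePartition n} {M : Set (Bool × ℤ)} {σ : Bool → Equiv.Perm ℤ}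
  {E : Set ℤ} {a : ℤ} {w : ℕ → Bool} {x : ℕ → ℤ} {m k t : ℕ} {sg : ℕ → ℤˣ}

namespace IsEdgeWalk

lemma lt_iff_of_isTurn (h : IsEdgeWalk σ E m w x) (turn : IsTurn (orient w x) (k + 1)) :
    x k < x (k + 1) ↔ x (k + 1) < x (k + 2) := by
  have := turn.2
  have := h.sign_succ k
  grind [orient]

lemma nilValue_of_internalTP (h : IsEdgeWalk σ E m w (phi σ a)) (hσ : P.IsModified M σ)
    (ht : t ∈ internalTP σ a m) (ht' : t + 1 ∈ internalTP σ a m) : P.NilValue σ a t := by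
  obtain ⟨turn, -⟩ := h.mem_internalTP_iff.1 ht
  obtain ⟨turn', htm⟩ := h.mem_internalTP_iff.1 ht'
  obtain ⟨k, rfl⟩ := Nat.exists_eq_add_of_le' turn.1
  have hk := h.lt_iff_of_isTurn turn
  have hk' := h.lt_iff_of_isTurn turn'
  have hprev : σ (w (k + 1)) (phi σ a (k + 2)) = phi σ a (k + 1) := h.apply_of_succ (k + 1)
  have hnext : σ (w (k + 1)) (phi σ a (k + 3)) = phi σ a (k + 4) := by
    rw [h.apply_succ (k + 3), h.sign_add_two_mul (k + 1) 1]
  have hne := h.ne_succ (k := k + 1) (by omega) (by omega)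
  have hne' := h.ne_succ (k := k + 3) (by omega) htm
  rcases lt_or_gt_of_ne (h.ne_succ (k := k + 2) (by omega) (by omega)) with hlt | hlt
  · exact hσ.isNil (c := w (k + 1)) hlt (by grind) (by grind)
  · exact P.isNil_comm.1 (hσ.isNil (c := w (k + 1)) hlt (by grind) (by grind))

lemma signature_eq_one_of_succ (h : IsEdgeWalk σ E m w (phi σ a)) (hσ : P.IsModified M σ)
    (hsg : P.IsSignature σ a m sg) (ht : t ∈ internalTP σ a m) (ht' : t + 1 ∈ internalTP σ a m) :
    sg t = 1 := by
  have hnil := h.nilValue_of_internalTP hσ ht ht'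
  by_cases hprev : P.NilValue σ a (t - 1)
  · exact (hsg t ht).2.2 hprev hnil
  · exact (hsg t ht).2.1 hprev hnil

end IsEdgeWalk

lemma DoublePartition.IsSignature.injOn_markedIndex (hsg : P.IsSignature σ a E.ncard sg)
    (hσ : P.IsModified M σ) (hE : IsMeander (σ true) (σ false) E) (hE1 : 1 < E.ncard) (ha : a ∈ E)
    (ha' : σ true a = a ∨ σ false a = a) :
    Set.InjOn (markedIndex sg) (internalTP σ a E.ncard) := by
  obtain ⟨w, h⟩ := exists_isEdgeWalk_phi (fun c ↦ (hσ c).1) hE hE1 ha ha'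
  have hpos {t} := h.signature_eq_one_of_succ (t := t) hσ hsg
  intro s hs t ht hst
  have := hs.1
  have := ht.1
  simp only [markedIndex] at hst
  grind

end Signatures

end Biparabolic

theorem proposition8p2_general (σ : Bool → Equiv.Perm ℤ) (hσ : ∀ c, Function.Involutive (σ c))
    (E : Set ℤ) (hE : IsMeander (σ true) (σ false) E) (hE1 : 1 < E.ncard)
    (a b : ℤ) (ha : a ∈ E) (hb : b ∈ E) (hab : a ≠ b)
    (ha' : σ true a = a ∨ σ false a = a) (hb' : σ true b = b ∨ σ false b = b)
    (sg : ℕ → ℤˣ) (hsg : Set.InjOn (markedIndex sg) (internalTP σ a E.ncard)) :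
    (∃ ψ, IsStraightening σ a E sg ψ) ∧
    ∀ ψ, IsStraightening σ a E sg ψ → ∀ astar bstar, astar = ψ 1 → bstar = ψ E.ncard →
      -- (i)
      (astar ∈ phi σ a '' TP σ a E.ncard true ∧ bstar ∈ phi σ a '' TP σ a E.ncard false) ∧
      -- (ii)
      ((negTP σ a E.ncard sg false).Nonempty →
        ∃ m s, IsGreatest (negTP σ a E.ncard sg false) m ∧
          IsLeast {u ∈ turningPoints σ a E.ncard | m < u} s ∧
          s ∈ TP σ a E.ncard true ∧ astar = phi σ a s) ∧
      (negTP σ a E.ncard sg false = ∅ →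
        ∃ s, IsLeast (TP σ a E.ncard true) s ∧ astar = phi σ a s) ∧
      -- (iii)
      ((negTP σ a E.ncard sg true).Nonempty →
        ∃ m s, IsGreatest (negTP σ a E.ncard sg true) m ∧
          IsLeast {u ∈ turningPoints σ a E.ncard | m < u} s ∧
          s ∈ TP σ a E.ncard false ∧ bstar = phi σ a s) ∧
      (negTP σ a E.ncard sg true = ∅ →
        ∃ s, IsLeast (TP σ a E.ncard false) s ∧ bstar = phi σ a s) ∧
      -- (iv)
      (astar = a ↔ a ∈ phi σ a '' TP σ a E.ncard true ∧ negTP σ a E.ncard sg false = ∅) ∧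
      -- (v)
      (astar = b ↔ b ∈ phi σ a '' TP σ a E.ncard true ∧
        ((internalTP σ a E.ncard).Nonempty →
          ∃ m, IsGreatest (internalTP σ a E.ncard ∩ TP σ a E.ncard false) m ∧ sg m = -1)) ∧
      -- (vi)
      (bstar = a ↔ a ∈ phi σ a '' TP σ a E.ncard false ∧ negTP σ a E.ncard sg true = ∅) ∧
      -- (vii)
      (bstar = b ↔ b ∈ phi σ a '' TP σ a E.ncard false ∧
        ((internalTP σ a E.ncard).Nonempty →
          ∃ m, IsGreatest (internalTP σ a E.ncard ∩ TP σ a E.ncard true) m ∧ sg m = -1)) := by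
  obtain ⟨w, h⟩ := exists_isEdgeWalk_phi hσ hE hE1 ha ha'
  obtain rfl : b = phi σ a E.ncard :=
    h.eq_last_of_fixed hb (by rwa [phi_one, ne_comm]) hb'
  refine ⟨h.exists_isStraightening hsg, fun ψ hψ _ _ hastar hbstar ↦ ?_⟩
  rw [hastar, hbstar, h.straightening_start hsg hψ, h.straightening_finish hsg hψ]
  exact ⟨⟨⟨_, h.pathEnd_mem_TP, rfl⟩, ⟨_, h.pathEnd_mem_TP, rfl⟩⟩,
    h.pathEnd_of_negTP_nonempty (c := true), h.pathEnd_of_negTP_eq_empty (c := true),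
    h.pathEnd_of_negTP_nonempty (c := false), h.pathEnd_of_negTP_eq_empty (c := false),
    h.pathEnd_eq_first_iff, h.pathEnd_eq_last_iff, h.pathEnd_eq_first_iff, h.pathEnd_eq_last_iff⟩

theorem proposition8p2 (n : ℕ) (hn : 1 < n) (P : DoublePartition n)
    (hunion : P.simpleRoots true ∪ P.simpleRoots false = Set.Ico (1 : ℤ) n)
    (hproper : P.simpleRoots true ∩ P.simpleRoots false ⊂ Set.Ico (1 : ℤ) n)
    (M : Set (Bool × ℤ)) (hM : P.IsMarking M)
    (σ : Bool → Equiv.Perm ℤ) (hσ : P.IsModified M σ)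
    (E : Set ℤ) (hE : IsEdge (σ true) (σ false) E) (hE1 : 1 < E.ncard)
    (a b : ℤ) (ha : a ∈ E) (hb : b ∈ E) (hab : a ≠ b)
    (ha' : σ true a = a ∨ σ false a = a) (hb' : σ true b = b ∨ σ false b = b)
    (sg : ℕ → ℤˣ) (hsg : P.IsSignature σ a E.ncard sg) :
    (∃ ψ, IsStraightening σ a E sg ψ) ∧
    ∀ ψ, IsStraightening σ a E sg ψ → ∀ astar bstar, astar = ψ 1 → bstar = ψ E.ncard →
      -- (i)
      (astar ∈ phi σ a '' TP σ a E.ncard true ∧ bstar ∈ phi σ a '' TP σ a E.ncard false) ∧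
      -- (ii)
      ((negTP σ a E.ncard sg false).Nonempty →
        ∃ m s, IsGreatest (negTP σ a E.ncard sg false) m ∧
          IsLeast {u ∈ turningPoints σ a E.ncard | m < u} s ∧
          s ∈ TP σ a E.ncard true ∧ astar = phi σ a s) ∧
      (negTP σ a E.ncard sg false = ∅ →
        ∃ s, IsLeast (TP σ a E.ncard true) s ∧ astar = phi σ a s) ∧
      -- (iii)
      ((negTP σ a E.ncard sg true).Nonempty →
        ∃ m s, IsGreatest (negTP σ a E.ncard sg true) m ∧
          IsLeast {u ∈ turningPoints σ a E.ncard | m < u} s ∧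
          s ∈ TP σ a E.ncard false ∧ bstar = phi σ a s) ∧
      (negTP σ a E.ncard sg true = ∅ →
        ∃ s, IsLeast (TP σ a E.ncard false) s ∧ bstar = phi σ a s) ∧
      -- (iv)
      (astar = a ↔ a ∈ phi σ a '' TP σ a E.ncard true ∧ negTP σ a E.ncard sg false = ∅) ∧
      -- (v)
      (astar = b ↔ b ∈ phi σ a '' TP σ a E.ncard true ∧
        ((internalTP σ a E.ncard).Nonempty →
          ∃ m, IsGreatest (internalTP σ a E.ncard ∩ TP σ a E.ncard false) m ∧ sg m = -1)) ∧
      -- (vi)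
      (bstar = a ↔ a ∈ phi σ a '' TP σ a E.ncard false ∧ negTP σ a E.ncard sg true = ∅) ∧
      -- (vii)
      (bstar = b ↔ b ∈ phi σ a '' TP σ a E.ncard false ∧
        ((internalTP σ a E.ncard).Nonempty →
          ∃ m, IsGreatest (internalTP σ a E.ncard ∩ TP σ a E.ncard true) m ∧ sg m = -1)) :=
  proposition8p2_general σ (fun c ↦ (hσ c).1) E hE.1 hE1 a b ha hb hab ha' hb' sg
    (hsg.injOn_markedIndex hσ hE.1 hE1 ha ha')
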